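/- Let $n\ge 1$, let $S^{n-1}$ be the Euclidean unit sphere of $\mathbb R^n$, $|\cdot|$ the Lebesgue measure on $\mathbb R^n$, $g$ a standard Gaussian random vector in $\mathbb R^n$, and $\sigma_q:=(\mathbb E|g_1|^q)^{1/q}$ for a standard Gaussian variable $g_1$. A Borel measure $\mu$ on $S^{n-1}$ (even or not) is called isotropic if $\|x\|_2^2=\int_{S^{n-1}}|\langle x,\theta\rangle|^2\,d\mu(\theta)$ for all $x\in\mathbb R^n$. For such $\mu$ and $1\le q<\infty$ put $\|x\|_{B_q(\mu)}:=\left(\int_{S^{n-1}}|\langle x,z\rangle|^q\,d\mu(z)\right)^{1/q}$, let $B_q(\mu)$ be the unit ball of this norm, and let $$k(B_q(\mu)):=\frac{\mathbb E\|g\|_{B_q(\mu)}^2}{\left(\max_{\theta\in S^{n-1}}\|\theta\|_{B_q(\mu)}\right)^2}$$ be its critical dimension. Let $B_p^n$ be the unit ball of $\ell_p^n$, i.e. of the norm $\left(\sum_{i=1}^n|x_i|^p\right)^{1/p}$. There are absolute constants $c,c_0,c_1,c_2,c_3>0$ such that for every $n\ge 1$ and every isotropic Borel measure $\mu$ on $S^{n-1}$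 the following hold. (i) For all $1\le q<\infty$, $\|g\|_{B_q(\mu)}^q$ is integrable and $\mathbb E\|g\|_{B_q(\mu)}^q=\sigma_q^q\,\mu(S^{n-1})$. (ii) $\mu(S^{n-1})=n$. (iii) For all $x\in\mathbb R^n$: $\|x\|_{B_p(\mu)}\le\|x\|_2$ for every $p$ with $2\le p<\infty$, and $\|x\|_{B_p(\mu)}\le n^{1/p-1/q}\|x\|_{B_q(\mu)}$ whenever $1\le p<q<\infty$. (iv) For all $1\le p<\infty$, $|B_p(\mu)|\le|B_p^n|$. (v) For all $1\le q<\infty$, $k(B_q(\mu))\ge c_0\,n^{\min\{1,2/q\}}$. (vi) For all $q$ with $2\le q\le c\log n$, $c_1\,q^{1/2}n^{1/q}\le\left(\mathbb E\|g\|_{B_q(\mu)}^2\right)^{1/2}\le c_2\,q^{1/2}n^{1/q}$, and consequently $k(B_q(\mu))\ge c_3\,q\,n^{2/q}$. -/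

import Mathlib

open MeasureTheory ProbabilityTheory

namespace IsotropicSphere

/-- The Euclidean unit sphere `S^{n-1}` of `ℝⁿ`, with its Borel σ-algebra. -/
abbrev UnitSphere (n : ℕ) : Type := Metric.sphere (0 : EuclideanSpace ℝ (Fin n)) 1

/-- A Borel measure `μ` on `S^{n-1}` is isotropic if `‖x‖₂² = ∫ |⟨x, θ⟩|² dμ(θ)` for all `x ∈ ℝⁿ`.

Evenness of `μ` is not required, so the even isotropic measures form a subclass. Finiteness is not
required either: a non-integrable integrand has Bochner integral `0 ≠ ‖x‖²` when `x ≠ 0`, so the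
condition forces `|⟨x, θ⟩|²` to be integrable for every `x`. -/
def IsIsotropic {n : ℕ} (μ : Measure (UnitSphere n)) : Prop :=
  ∀ x : EuclideanSpace ℝ (Fin n),
    ‖x‖ ^ 2 = ∫ θ : UnitSphere n, |inner ℝ x (θ : EuclideanSpace ℝ (Fin n))| ^ 2 ∂μ

/-- The norm `‖x‖_{B_q(μ)} = (∫ |⟨x, z⟩|^q dμ(z))^{1/q}`. -/
noncomputable def bodyNorm {n : ℕ} (μ : Measure (UnitSphere n)) (q : ℝ)
    (x : EuclideanSpace ℝ (Fin n)) : ℝ :=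
  (∫ z : UnitSphere n, |inner ℝ x (z : EuclideanSpace ℝ (Fin n))| ^ q ∂μ) ^ (1 / q)

/-- The body `B_q(μ)`, the unit ball of `‖·‖_{B_q(μ)}`. -/
def body {n : ℕ} (μ : Measure (UnitSphere n)) (q : ℝ) : Set (EuclideanSpace ℝ (Fin n)) :=
  {x | bodyNorm μ q x ≤ 1}

/-- The unit ball `B_p^n` of `ℓ_p^n`, as a subset of Euclidean space. -/
def lpBall (n : ℕ) (p : ℝ) : Set (EuclideanSpace ℝ (Fin n)) :=
  {x | (∑ i, |x i| ^ p) ^ (1 / p) ≤ 1}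

/-- The standard Gaussian measure `γ_n` on `ℝⁿ`. -/
noncomputable abbrev gaussian (n : ℕ) : Measure (EuclideanSpace ℝ (Fin n)) :=
  stdGaussian (EuclideanSpace ℝ (Fin n))

/-- `σ_p = (E|g₁|^p)^{1/p}` for a standard Gaussian random variable `g₁`. -/
noncomputable def gaussianMoment (p : ℝ) : ℝ :=
  (∫ t : ℝ, |t| ^ p ∂(gaussianReal 0 1)) ^ (1 / p)

/-- `b(X) = max_{θ ∈ S^{n-1}} ‖θ‖_X` for the norm `N = ‖·‖_X`. -/
noncomputable def maxOnSphere {n : ℕ} (N : EuclideanSpace ℝ (Fin n) → ℝ) : ℝ :=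
  ⨆ θ : UnitSphere n, N (θ : EuclideanSpace ℝ (Fin n))

/-- The critical dimension `k(X) = E‖g‖_X² / b(X)²` of `X = (ℝⁿ, N)`. -/
noncomputable def criticalDim {n : ℕ} (N : EuclideanSpace ℝ (Fin n) → ℝ) : ℝ :=
  (∫ x, N x ^ 2 ∂(gaussian n)) / maxOnSphere N ^ 2

end IsotropicSphere

namespace IsotropicSphere

/-! ### Isotropic measures and the norms `bodyNorm μ q`. -/

section Basic

variable {n : ℕ} {μ : Measure (UnitSphere n)}

/-! Isotropy says that `bodyNorm μ 2` is the Euclidean norm; summed over an orthonormal basis it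
gives `μ` mass `n`. Hölder and `|⟨x, z⟩| ≤ ‖x‖` then give (iii). As `⟨g, z⟩` is standard normal for
unit `z`, Fubini gives (i).

For (v), bound the maximum on the sphere by (iii) and carry a Gaussian mean from exponent 1 (if `q ≤
2`) or 2 (if `q ≥ 2`) to `q` by Hölder.

For (vi), take `q = 2m` and `Y = ‖g‖ ^ (2m)`, with mean `evenMoment m * n`. The second moment of `Y`
is a double integral over `μ × μ` of mixed moments of two Gaussians with correlation `ρ = ⟨z, w⟩`.
These exceed the independent value by at most `ρ²` times an exponential factor
(`integral_inner_pow_even_mul_le`), and `ρ²` has integral only `n`, against total mass `n²`. So `E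
Y² ≤ 2 (E Y)²` once `16 ^ m ≤ n`, and `E Y ^ (1/m)` is comparable to `(E Y) ^ (1/m)`, which is of
order `m * n ^ (1/m)`. Hölder passes from even to real exponents.

For (iv), `|B_p(μ)|` is `∫ exp (-‖x‖ ^ p)` over a Gamma factor, and the geometric Brascamp-Lieb
inequality bounds the integral by its value for `ℓ_p^n`. That inequality comes from transport: with
`T` carrying the density `f` to a Gaussian of equal mass, change variables by `x ↦ ∫ T(⟨x, z⟩) z
dμ(z)`. `exp_integral_log_le_det` controls the Jacobian, `norm_sphereMap_sq_le` the Gaussian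
exponent. -/

lemma norm_coe_sphere (z : UnitSphere n) : ‖(z : EuclideanSpace ℝ (Fin n))‖ = 1 :=
  mem_sphere_zero_iff_norm.1 z.2

lemma abs_inner_sphere_le (x : EuclideanSpace ℝ (Fin n)) (z : UnitSphere n) :
    |inner ℝ x (z : EuclideanSpace ℝ (Fin n))| ≤ ‖x‖ := by
  simpa [norm_coe_sphere] using abs_real_inner_le_norm x (z : EuclideanSpace ℝ (Fin n))

lemma IsIsotropic.integrable_sq (hμ : IsIsotropic μ) (x : EuclideanSpace ℝ (Fin n)) :
    Integrable (fun θ : UnitSphere n => |inner ℝ x (θ : EuclideanSpace ℝ (Fin n))| ^ 2) μ := by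
  by_contra h
  have hx := hμ x
  rw [integral_undef h] at hx
  have : x = 0 := by simpa using hx
  subst this
  simp at h

lemma sum_abs_inner_basisFun_sq (x : EuclideanSpace ℝ (Fin n)) :
    ∑ i, |inner ℝ (EuclideanSpace.basisFun (Fin n) ℝ i) x| ^ 2 = ‖x‖ ^ 2 := by
  simp_rw [sq_abs]
  exact (EuclideanSpace.basisFun (Fin n) ℝ).sum_sq_inner_right x

/-- The constant `1 = ‖θ‖²` is the sum of the integrable squared coordinates of `θ`. -/
lemma IsIsotropic.isFiniteMeasure (hμ : IsIsotropic μ) : IsFiniteMeasure μ := by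
  have h : Integrable (fun _ : UnitSphere n => (1 : ℝ)) μ := by
    have := integrable_finsetSum Finset.univ fun i _ =>
      hμ.integrable_sq (EuclideanSpace.basisFun (Fin n) ℝ i)
    refine this.congr (Filter.Eventually.of_forall fun θ => ?_)
    simp only [sum_abs_inner_basisFun_sq, norm_coe_sphere, one_pow]
  exact (integrable_const_iff_isFiniteMeasure one_ne_zero).1 h

lemma IsIsotropic.measureReal_univ (hμ : IsIsotropic μ) : μ.real Set.univ = n := by
  have : ∫ θ : UnitSphere n, ∑ i, |inner ℝ (EuclideanSpace.basisFun (Fin n) ℝ i)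
      (θ : EuclideanSpace ℝ (Fin n))| ^ 2 ∂μ = n := by
    rw [integral_finsetSum _ fun i _ => hμ.integrable_sq _]
    rw [Finset.sum_congr rfl fun i _ => (hμ _).symm]
    simp
  simp_rw [sum_abs_inner_basisFun_sq, norm_coe_sphere] at this
  simpa using this

lemma IsIsotropic.measure_univ (hμ : IsIsotropic μ) : μ Set.univ = (n : ENNReal) := by
  have := hμ.isFiniteMeasure
  have h := hμ.measureReal_univ
  rw [measureReal_def] at h
  rw [← ENNReal.ofReal_toReal (measure_ne_top μ Set.univ), h, ENNReal.ofReal_natCast]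

lemma integrable_comp_inner [IsFiniteMeasure μ] {f : ℝ → ℝ} (hf : Continuous f)
    (x : EuclideanSpace ℝ (Fin n)) :
    Integrable (fun z : UnitSphere n => f (inner ℝ x (z : EuclideanSpace ℝ (Fin n)))) μ := by
  have : Continuous (fun z : UnitSphere n => f (inner ℝ x (z : EuclideanSpace ℝ (Fin n)))) := by
    fun_prop
  exact this.integrable_of_hasCompactSupport (HasCompactSupport.of_compactSpace _)

lemma continuous_abs_rpow {q : ℝ} (hq : 0 ≤ q) : Continuous fun t : ℝ => |t| ^ q :=
  continuous_abs.rpow_const fun _ => Or.inr hq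

lemma integral_abs_inner_rpow_nonneg (q : ℝ) (x : EuclideanSpace ℝ (Fin n)) :
    0 ≤ ∫ z : UnitSphere n, |inner ℝ x (z : EuclideanSpace ℝ (Fin n))| ^ q ∂μ :=
  integral_nonneg fun _ => by positivity

lemma bodyNorm_nonneg (q : ℝ) (x : EuclideanSpace ℝ (Fin n)) : 0 ≤ bodyNorm μ q x :=
  Real.rpow_nonneg (integral_abs_inner_rpow_nonneg q x) _

lemma bodyNorm_rpow {q : ℝ} (hq : q ≠ 0) (x : EuclideanSpace ℝ (Fin n)) :
    bodyNorm μ q x ^ q =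
      ∫ z : UnitSphere n, |inner ℝ x (z : EuclideanSpace ℝ (Fin n))| ^ q ∂μ := by
  rw [bodyNorm, ← Real.rpow_mul (integral_abs_inner_rpow_nonneg q x), one_div_mul_cancel hq,
    Real.rpow_one]

lemma memLp_inner [IsFiniteMeasure μ] (p : ENNReal) (x : EuclideanSpace ℝ (Fin n)) :
    MemLp (fun z : UnitSphere n => inner ℝ x (z : EuclideanSpace ℝ (Fin n))) p μ :=
  MemLp.of_bound (by fun_prop : Continuous _).aestronglyMeasurable ‖x‖
    (Filter.Eventually.of_forall fun z => abs_inner_sphere_le x z)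

lemma ofReal_bodyNorm [IsFiniteMeasure μ] {q : ℝ} (hq : 0 < q) (x : EuclideanSpace ℝ (Fin n)) :
    ENNReal.ofReal (bodyNorm μ q x) =
      eLpNorm (fun z : UnitSphere n => inner ℝ x (z : EuclideanSpace ℝ (Fin n)))
        (ENNReal.ofReal q) μ := by
  rw [(memLp_inner _ x).eLpNorm_eq_integral_rpow_norm (by simpa using hq) ENNReal.ofReal_ne_top,
    ENNReal.toReal_ofReal hq.le, bodyNorm, one_div]
  rfl

/-- Hölder on a space of finite mass. -/
lemma bodyNorm_le_mul_measureReal_rpow [IsFiniteMeasure μ] {p q : ℝ} (hp : 1 ≤ p) (hpq : p ≤ q)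
    (x : EuclideanSpace ℝ (Fin n)) :
    bodyNorm μ p x ≤ μ.real Set.univ ^ (1 / p - 1 / q) * bodyNorm μ q x := by
  have hp0 : 0 < p := by linarith
  have hq0 : 0 < q := by linarith
  have hpow : 0 ≤ 1 / p - 1 / q := sub_nonneg.2 (one_div_le_one_div_of_le hp0 hpq)
  have h := eLpNorm_le_eLpNorm_mul_rpow_measure_univ (μ := μ) (ENNReal.ofReal_le_ofReal hpq)
    (memLp_inner (μ := μ) 1 x).1
  rw [← ofReal_bodyNorm hp0, ← ofReal_bodyNorm hq0, ENNReal.toReal_ofReal hp0.le,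
    ENNReal.toReal_ofReal hq0.le, ← ENNReal.ofReal_toReal (measure_ne_top μ Set.univ),
    ENNReal.ofReal_rpow_of_nonneg ENNReal.toReal_nonneg hpow,
    ← ENNReal.ofReal_mul (bodyNorm_nonneg _ _)] at h
  rw [ENNReal.ofReal_le_ofReal_iff (mul_nonneg (bodyNorm_nonneg _ _) (by positivity))] at h
  rwa [mul_comm]

lemma IsIsotropic.bodyNorm_le (hμ : IsIsotropic μ) {p q : ℝ} (hp : 1 ≤ p) (hpq : p ≤ q)
    (x : EuclideanSpace ℝ (Fin n)) :
    bodyNorm μ p x ≤ (n : ℝ) ^ (1 / p - 1 / q) * bodyNorm μ q x := by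
  have := hμ.isFiniteMeasure
  rw [← hμ.measureReal_univ]
  exact bodyNorm_le_mul_measureReal_rpow hp hpq x

lemma IsIsotropic.bodyNorm_two (hμ : IsIsotropic μ) (x : EuclideanSpace ℝ (Fin n)) :
    bodyNorm μ 2 x = ‖x‖ := by
  have h := hμ x
  simp_rw [bodyNorm, Real.rpow_two]
  rw [← h, ← Real.sqrt_eq_rpow, Real.sqrt_sq (norm_nonneg _)]

lemma IsIsotropic.bodyNorm_le_norm (hμ : IsIsotropic μ) {p : ℝ} (hp : 2 ≤ p)
    (x : EuclideanSpace ℝ (Fin n)) : bodyNorm μ p x ≤ ‖x‖ := by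
  have := hμ.isFiniteMeasure
  have hp0 : 0 < p := by linarith
  rw [← Real.rpow_le_rpow_iff (bodyNorm_nonneg _ _) (norm_nonneg _) hp0, bodyNorm_rpow hp0.ne']
  -- Split off the square, which isotropy integrates, and bound the remaining power by that of
  -- `‖x‖`.
  have key : ∀ t : ℝ, 0 ≤ t → t ^ p = t ^ (p - 2) * t ^ 2 := fun t ht => by
    rw [← Real.rpow_two, ← Real.rpow_add_of_nonneg ht (by linarith) (by norm_num)]
    ring_nf
  rw [key _ (norm_nonneg x), hμ x, ← integral_const_mul]
  refine integral_mono (integrable_comp_inner (continuous_abs_rpow hp0.le) x)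
    ((hμ.integrable_sq x).const_mul _) fun z => ?_
  simp only
  rw [key _ (abs_nonneg _)]
  gcongr
  exact abs_inner_sphere_le x z

lemma bodyNorm_add_le [IsFiniteMeasure μ] {q : ℝ} (hq : 1 ≤ q) (x y : EuclideanSpace ℝ (Fin n)) :
    bodyNorm μ q (x + y) ≤ bodyNorm μ q x + bodyNorm μ q y := by
  have hq0 : 0 < q := by linarith
  rw [← ENNReal.ofReal_le_ofReal_iff (add_nonneg (bodyNorm_nonneg _ _) (bodyNorm_nonneg _ _)),
    ENNReal.ofReal_add (bodyNorm_nonneg _ _) (bodyNorm_nonneg _ _), ofReal_bodyNorm hq0,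
    ofReal_bodyNorm hq0, ofReal_bodyNorm hq0]
  have := eLpNorm_add_le (memLp_inner (μ := μ) 1 x).1 (memLp_inner (μ := μ) 1 y).1
    (p := ENNReal.ofReal q) (by simpa using hq)
  convert this using 2
  ext z
  simp [inner_add_left]

lemma bodyNorm_smul {q : ℝ} (hq : 0 < q) (r : ℝ) (x : EuclideanSpace ℝ (Fin n)) :
    bodyNorm μ q (r • x) = |r| * bodyNorm μ q x := by
  simp_rw [bodyNorm, inner_smul_left, abs_mul, Real.mul_rpow (abs_nonneg _) (abs_nonneg _)]
  rw [integral_const_mul, Real.mul_rpow (by positivity) (integral_abs_inner_rpow_nonneg _ _),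
    ← Real.rpow_mul (by positivity), mul_one_div_cancel hq.ne', Real.rpow_one]
  simp

lemma bodyNorm_zero {q : ℝ} (hq : 0 < q) : bodyNorm μ q (0 : EuclideanSpace ℝ (Fin n)) = 0 := by
  simpa using bodyNorm_smul (μ := μ) hq 0 0

lemma bodyNorm_neg (q : ℝ) (x : EuclideanSpace ℝ (Fin n)) :
    bodyNorm μ q (-x) = bodyNorm μ q x := by
  simp [bodyNorm, inner_neg_left]

/-- For `q ≤ 2` the split `t² = t^(2-q) t^q` runs the other way; this yields definiteness of the
norm below exponent 2. -/
lemma IsIsotropic.norm_rpow_le (hμ : IsIsotropic μ) {q : ℝ} (hq : 1 ≤ q) (hq2 : q ≤ 2)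
    (x : EuclideanSpace ℝ (Fin n)) : ‖x‖ ^ q ≤ bodyNorm μ q x ^ q := by
  have := hμ.isFiniteMeasure
  obtain rfl | hx := eq_or_ne x 0
  · rw [norm_zero, Real.zero_rpow (by linarith)]
    exact Real.rpow_nonneg (bodyNorm_nonneg _ _) _
  have hx' : 0 < ‖x‖ := norm_pos_iff.2 hx
  have key : ∀ t : ℝ, 0 ≤ t → t ^ 2 = t ^ (2 - q) * t ^ q := fun t ht => by
    rw [← Real.rpow_two, ← Real.rpow_add_of_nonneg ht (by linarith) (by linarith)]
    ring_nf
  have h : ‖x‖ ^ 2 ≤ ‖x‖ ^ (2 - q) * bodyNorm μ q x ^ q := by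
    rw [hμ x, bodyNorm_rpow (by linarith), ← integral_const_mul]
    refine integral_mono (hμ.integrable_sq x)
      ((integrable_comp_inner (continuous_abs_rpow (by linarith)) x).const_mul _) fun z => ?_
    simp only
    rw [key _ (abs_nonneg _)]
    gcongr
    exact abs_inner_sphere_le x z
  rw [key _ hx'.le] at h
  exact le_of_mul_le_mul_left h (Real.rpow_pos_of_pos hx' _)

lemma IsIsotropic.bodyNorm_pos (hμ : IsIsotropic μ) (hn : 1 ≤ n) {q : ℝ} (hq : 1 ≤ q)
    {x : EuclideanSpace ℝ (Fin n)} (hx : x ≠ 0) : 0 < bodyNorm μ q x := by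
  have hx' : 0 < ‖x‖ := norm_pos_iff.2 hx
  have hn' : (0 : ℝ) < n := by exact_mod_cast hn
  rcases le_total q 2 with h | h
  · by_contra h0
    have h1 : bodyNorm μ q x = 0 := le_antisymm (not_lt.1 h0) (bodyNorm_nonneg _ _)
    have h2 := hμ.norm_rpow_le hq h x
    rw [h1, Real.zero_rpow (by linarith)] at h2
    exact absurd h2 (not_le.2 (Real.rpow_pos_of_pos hx' _))
  · have h2 := hμ.bodyNorm_le one_le_two h x
    rw [hμ.bodyNorm_two] at h2
    exact pos_of_mul_pos_right (hx'.trans_le h2) (by positivity)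

lemma IsIsotropic.bodyNorm_le_const (hμ : IsIsotropic μ) {q : ℝ} (hq : 1 ≤ q) :
    ∃ C : ℝ, 0 ≤ C ∧ ∀ x : EuclideanSpace ℝ (Fin n), bodyNorm μ q x ≤ C * ‖x‖ := by
  rcases le_total q 2 with h | h
  · refine ⟨(n : ℝ) ^ (1 / q - 1 / 2), by positivity, fun x => ?_⟩
    rw [← hμ.bodyNorm_two x]
    exact hμ.bodyNorm_le hq h x
  · exact ⟨1, zero_le_one, fun x => by simpa using hμ.bodyNorm_le_norm h x⟩

lemma continuous_bodyNorm [IsFiniteMeasure μ] {q : ℝ} (hq : 1 ≤ q) :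
    Continuous (bodyNorm μ q) := by
  have hq0 : 0 < q := by linarith
  refine Continuous.rpow_const ?_ fun _ => Or.inr (by positivity)
  have := continuous_parametric_integral_of_continuous (μ := μ) (s := Set.univ)
    (f := fun (x : EuclideanSpace ℝ (Fin n)) (z : UnitSphere n) =>
      |inner ℝ x (z : EuclideanSpace ℝ (Fin n))| ^ q)
    ((continuous_abs_rpow hq0.le).comp (by fun_prop)) isCompact_univ
  simpa using this

end Basic

/-! ### Moments of one-dimensional Gaussians. -/

/-- The even moments `1 · 3 ⋯ (2k - 1)` of the standard Gaussian. -/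
def evenMoment (k : ℕ) : ℝ := ∏ i ∈ Finset.range k, (2 * (i : ℝ) + 1)

lemma evenMoment_succ (k : ℕ) : evenMoment (k + 1) = evenMoment k * (2 * k + 1) :=
  Finset.prod_range_succ _ _

lemma evenMoment_pos (k : ℕ) : 0 < evenMoment k := Finset.prod_pos fun _ _ => by positivity

lemma evenMoment_mul_le (a b : ℕ) : evenMoment a * evenMoment b ≤ evenMoment (a + b) := by
  induction b with
  | zero => simp [evenMoment]
  | succ b ih =>
    rw [evenMoment_succ, ← add_assoc, evenMoment_succ, ← mul_assoc]
    have := evenMoment_pos (a + b)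
    gcongr
    simp

/-- Pair consecutive factors: `(4m+1)(4m+3) ≤ 4(2m+1)²`. -/
lemma evenMoment_two_mul_le (m : ℕ) : evenMoment (2 * m) ≤ 4 ^ m * evenMoment m ^ 2 := by
  induction m with
  | zero => simp [evenMoment]
  | succ m ih =>
    rw [mul_add, mul_one, show 2 * m + 2 = (2 * m + 1) + 1 by ring, evenMoment_succ,
      evenMoment_succ, evenMoment_succ]
    push_cast
    calc evenMoment (2 * m) * (2 * (2 * (m : ℝ)) + 1) * (2 * (2 * m + 1) + 1)
        = evenMoment (2 * m) * ((2 * (2 * (m : ℝ)) + 1) * (2 * (2 * m + 1) + 1)) := by ring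
      _ ≤ (4 ^ m * evenMoment m ^ 2) * (4 * (2 * m + 1) ^ 2) := by
        refine mul_le_mul ih ?_ (by positivity) (by positivity)
        nlinarith
      _ = _ := by ring

lemma evenMoment_le_pow (m : ℕ) : evenMoment m ≤ (2 * m) ^ m := by
  calc evenMoment m ≤ ∏ _i ∈ Finset.range m, (2 * (m : ℝ)) :=
        Finset.prod_le_prod (fun _ _ => by positivity) fun i hi => by
          have : (i : ℝ) + 1 ≤ m := by exact_mod_cast Finset.mem_range.1 hi
          linarith
    _ = _ := by simp

lemma factorial_le_evenMoment (m : ℕ) : (m.factorial : ℝ) ≤ evenMoment m := by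
  induction m with
  | zero => simp [evenMoment]
  | succ m ih =>
    rw [evenMoment_succ, Nat.factorial_succ, mul_comm]
    push_cast
    have := evenMoment_pos m
    gcongr
    linarith

lemma pow_le_evenMoment (m : ℕ) : ((m : ℝ) / 3) ^ m ≤ evenMoment m := by
  refine le_trans ?_ (factorial_le_evenMoment m)
  have h := Real.pow_div_factorial_le_exp (m : ℝ) (by positivity) m
  have h3 : Real.exp m ≤ 3 ^ m := by
    rw [← Real.exp_one_pow]
    gcongr
    exact Real.exp_one_lt_three.le
  rw [div_le_iff₀ (by positivity)] at h
  rw [div_pow, div_le_iff₀ (by positivity), mul_comm]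
  exact h.trans (by gcongr)

lemma integrable_abs_rpow_gaussianReal {q : ℝ} (hq : 0 < q) (v : NNReal) :
    Integrable (fun t : ℝ => |t| ^ q) (gaussianReal 0 v) := by
  have := (memLp_id_gaussianReal' (μ := 0) (v := v) (ENNReal.ofReal q)
    ENNReal.ofReal_ne_top).integrable_norm_rpow (by simpa using hq) ENNReal.ofReal_ne_top
  rw [ENNReal.toReal_ofReal hq.le] at this
  simpa using this

lemma integrable_pow_gaussianReal (k : ℕ) (v : NNReal) :
    Integrable (fun t : ℝ => t ^ k) (gaussianReal 0 v) := by
  have := (memLp_id_gaussianReal (μ := 0) (v := v) (k : NNReal)).integrable_norm_pow'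
  refine this.mono (by fun_prop) (Filter.Eventually.of_forall fun t => ?_)
  simp

lemma Gamma_add_half (k : ℕ) :
    Real.Gamma (k + 1 / 2) = √Real.pi * evenMoment k / 2 ^ k := by
  induction k with
  | zero => simpa [evenMoment] using Real.Gamma_one_half_eq
  | succ k ih =>
    rw [show ((k + 1 : ℕ) : ℝ) + 1 / 2 = (k + 1 / 2) + 1 by push_cast; ring,
      Real.Gamma_add_one (by positivity), ih, evenMoment_succ]
    field

lemma integral_pow_even_gaussianReal (k : ℕ) :
    ∫ t : ℝ, t ^ (2 * k) ∂(gaussianReal 0 1) = evenMoment k := by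
  rw [integral_gaussianReal_eq_integral_smul one_ne_zero]
  have h1 : ∀ x : ℝ, gaussianPDFReal 0 1 x • x ^ (2 * k) =
      (√(2 * Real.pi))⁻¹ * (|x| ^ ((2 * k : ℕ) : ℝ) * Real.exp (-(1 / 2) * |x| ^ (2 : ℝ))) := by
    intro x
    rw [Real.rpow_natCast, Real.rpow_two, pow_mul, pow_mul, sq_abs, gaussianPDFReal, smul_eq_mul]
    simp
    ring_nf
  simp_rw [h1]
  rw [integral_const_mul,
    integral_comp_abs (f := fun y : ℝ => y ^ ((2 * k : ℕ) : ℝ) * Real.exp (-(1 / 2) * y ^ (2 : ℝ))),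
    integral_rpow_mul_exp_neg_mul_rpow two_pos (by have : (0:ℝ) ≤ ((2 * k : ℕ) : ℝ) := by positivity
                                                   linarith) (by norm_num),
    show (((2 * k : ℕ) : ℝ) + 1) / 2 = k + 1 / 2 by push_cast; ring, Gamma_add_half,
    show -(((2 * k : ℕ) : ℝ) + 1) / 2 = -(k + 1 / 2) by push_cast; ring, one_div (2 : ℝ),
    Real.inv_rpow two_pos.le, Real.rpow_neg two_pos.le, inv_inv, Real.rpow_add two_pos,
    Real.rpow_natCast, show (2 : ℝ) ^ (2⁻¹ : ℝ) = √2 by rw [Real.sqrt_eq_rpow, one_div], Real.sqrt_mul two_pos.le]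
  have := Real.pi_pos
  field

lemma integral_pow_odd_gaussianReal {k : ℕ} (hk : Odd k) (v : NNReal) :
    ∫ t : ℝ, t ^ k ∂(gaussianReal 0 v) = 0 := by
  have h : ∫ t : ℝ, t ^ k ∂((gaussianReal 0 v).map fun x => -x) = ∫ t, (-t) ^ k ∂(gaussianReal 0 v) :=
    integral_map (by fun_prop) (by fun_prop)
  rw [gaussianReal_map_neg, neg_zero] at h
  simp_rw [hk.neg_pow, integral_neg] at h
  linarith

/-- Scaling by `√v`. The variance below 1 is that of the part of one Gaussian independent of
another. -/
lemma integral_pow_even_gaussianReal_le {v : NNReal} (hv : v ≤ 1) (k : ℕ) :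
    ∫ t : ℝ, t ^ (2 * k) ∂(gaussianReal 0 v) ≤ evenMoment k := by
  have h0 : (gaussianReal 0 1).map (fun x => √v * x) = gaussianReal 0 v := by
    rw [gaussianReal_map_const_mul]
    congr 1
    · simp
    · ext; simp
  have h : ∫ t : ℝ, t ^ (2 * k) ∂((gaussianReal 0 1).map fun x => √v * x) =
      ∫ t, (√v * t) ^ (2 * k) ∂(gaussianReal 0 1) := integral_map (by fun_prop) (by fun_prop)
  rw [← h0, h]
  simp_rw [mul_pow]
  rw [integral_const_mul, integral_pow_even_gaussianReal, pow_mul, Real.sq_sqrt v.coe_nonneg]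
  exact mul_le_of_le_one_left (evenMoment_pos k).le (pow_le_one₀ v.coe_nonneg hv)

/-! ### Gaussian marginals and mixed moments. -/

section

variable {n : ℕ}

lemma map_inner_gaussian (w : EuclideanSpace ℝ (Fin n)) :
    (gaussian n).map (fun x => inner ℝ x w) = gaussianReal 0 (‖w‖₊ ^ 2) := by
  have h := IsGaussian.map_eq_gaussianReal (μ := gaussian n) (innerSL ℝ w)
  rw [integral_strongDual_stdGaussian, variance_dual_stdGaussian] at h
  convert h using 2
  · ext x
    simp [real_inner_comm]
  · ext; simp

/-- The pair is jointly Gaussian with covariance `⟨z, w⟩`, and uncorrelated jointly Gaussian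
variables are independent. -/
lemma indepFun_inner_gaussian {z w : EuclideanSpace ℝ (Fin n)} (h : inner ℝ z w = 0) :
    IndepFun (fun x => inner ℝ x z) (fun x => inner ℝ x w) (gaussian n) := by
  have hg : HasGaussianLaw (fun x : EuclideanSpace ℝ (Fin n) => (inner ℝ x z, inner ℝ x w))
      (gaussian n) := by
    have := (IsGaussian.hasGaussianLaw_id (μ := gaussian n)).map_fun
      ((innerSL ℝ z).prod (innerSL ℝ w))
    simpa [real_inner_comm] using this
  refine hg.indepFun_of_covariance_eq_zero ?_
  have := covarianceBilin_apply_eq_cov (μ := gaussian n) IsGaussian.memLp_two_id z w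
  rw [covarianceBilin_stdGaussian, innerSL_apply_apply, h] at this
  rw [this]
  simp_rw [real_inner_comm]

end

section

variable {n : ℕ}

lemma integral_inner_gaussian {f : ℝ → ℝ} (hf : Continuous f) (w : EuclideanSpace ℝ (Fin n)) :
    ∫ x, f (inner ℝ x w) ∂(gaussian n) = ∫ t, f t ∂(gaussianReal 0 (‖w‖₊ ^ 2)) := by
  rw [← map_inner_gaussian, integral_map (by fun_prop) (by fun_prop)]

lemma nnnorm_coe_sphere_sq (z : UnitSphere n) : ‖(z : EuclideanSpace ℝ (Fin n))‖₊ ^ 2 = 1 := by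
  ext; simp

lemma integrable_norm_rpow_gaussian {q : ℝ} (hq : 0 < q) :
    Integrable (fun x : EuclideanSpace ℝ (Fin n) => ‖x‖ ^ q) (gaussian n) := by
  have := (IsGaussian.memLp_id (gaussian n) (ENNReal.ofReal q)
    ENNReal.ofReal_ne_top).integrable_norm_rpow (by simpa using hq) ENNReal.ofReal_ne_top
  rwa [ENNReal.toReal_ofReal hq.le] at this

lemma integrable_norm_pow_gaussian (k : ℕ) :
    Integrable (fun x : EuclideanSpace ℝ (Fin n) => ‖x‖ ^ k) (gaussian n) :=
  (IsGaussian.memLp_id (gaussian n) k (by simp)).integrable_norm_pow'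

lemma integrable_inner_pow_gaussian (k : ℕ) (w : EuclideanSpace ℝ (Fin n)) :
    Integrable (fun x => (inner ℝ x w) ^ k) (gaussian n) := by
  have := integrable_pow_gaussianReal k (‖w‖₊ ^ 2)
  rw [← map_inner_gaussian] at this
  exact this.comp_measurable (by fun_prop)

lemma integral_inner_pow_mul_inner_pow {z w : EuclideanSpace ℝ (Fin n)} (h : inner ℝ z w = 0)
    (a b : ℕ) :
    ∫ x, (inner ℝ x z) ^ a * (inner ℝ x w) ^ b ∂(gaussian n) =
      (∫ t, t ^ a ∂(gaussianReal 0 (‖z‖₊ ^ 2))) * ∫ t, t ^ b ∂(gaussianReal 0 (‖w‖₊ ^ 2)) := by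
  rw [← integral_inner_gaussian (by fun_prop) z, ← integral_inner_gaussian (by fun_prop) w]
  exact (indepFun_inner_gaussian h).integral_fun_comp_mul_comp (f := fun t => t ^ a)
    (g := fun t => t ^ b) (by fun_prop) (by fun_prop) (by fun_prop) (by fun_prop)

lemma integrable_inner_pow_mul_inner_pow {z w : EuclideanSpace ℝ (Fin n)} (h : inner ℝ z w = 0)
    (a b : ℕ) : Integrable (fun x => (inner ℝ x z) ^ a * (inner ℝ x w) ^ b) (gaussian n) :=
  ((indepFun_inner_gaussian h).comp (φ := fun t => t ^ a) (ψ := fun t => t ^ b)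
    (by fun_prop) (by fun_prop)).integrable_mul (integrable_inner_pow_gaussian a z)
    (integrable_inner_pow_gaussian b w)

/-- One term of the binomial expansion of a mixed moment. Odd `k` contributes an odd moment, hence
0; `k = 0` is the independent case; for even `k ≥ 2`, `|ρ| ≤ 1` gives `ρ^k ≤ ρ²` and
supermultiplicativity of `evenMoment` absorbs the moments. -/
lemma pow_mul_moment_le {ρ : ℝ} (hρ : |ρ| ≤ 1) {v : NNReal} (hv : v ≤ 1) {m k : ℕ}
    (hk : k ≤ 2 * m) :
    ρ ^ k * ((∫ t : ℝ, t ^ (2 * m + k) ∂(gaussianReal 0 1)) *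
        ∫ t : ℝ, t ^ (2 * m - k) ∂(gaussianReal 0 v)) ≤
      (if k = 0 then evenMoment m ^ 2 else 0) + ρ ^ 2 * evenMoment (2 * m) := by
  have hpos := evenMoment_pos (2 * m)
  rcases Nat.even_or_odd' k with ⟨j, rfl | rfl⟩
  · rw [← mul_add, ← Nat.mul_sub, integral_pow_even_gaussianReal]
    have h := integral_pow_even_gaussianReal_le hv (m - j)
    rcases Nat.eq_zero_or_pos j with rfl | hj
    · have hm := evenMoment_pos m
      simp only [mul_zero, pow_zero, one_mul, add_zero, Nat.sub_zero, if_true] at h ⊢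
      nlinarith [sq_nonneg ρ, mul_nonneg (sq_nonneg ρ) hpos.le]
    · rw [if_neg (by omega), zero_add]
      have h2 : evenMoment (m + j) * evenMoment (m - j) ≤ evenMoment (2 * m) :=
        (evenMoment_mul_le _ _).trans_eq (by congr 1; omega)
      have h3 : ρ ^ (2 * j) ≤ ρ ^ 2 := by
        rw [pow_mul]
        exact pow_le_of_le_one (sq_nonneg ρ) ((sq_le_one_iff_abs_le_one ρ).2 hρ) (by omega)
      refine mul_le_mul h3 ((mul_le_mul_of_nonneg_left h (evenMoment_pos _).le).trans h2) ?_
        (sq_nonneg ρ)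
      exact mul_nonneg (evenMoment_pos _).le
        (integral_nonneg fun t => by simp only [pow_mul]; positivity)
  · rw [integral_pow_odd_gaussianReal (by rw [← add_assoc, ← mul_add]; exact odd_two_mul_add_one _)]
    simp only [zero_mul, mul_zero]
    positivity

/-- Bound on the mixed even moments of two standard Gaussian variables with correlation
`⟨z, w⟩`. -/
lemma integral_inner_pow_even_mul_le (z w : UnitSphere n) (m : ℕ) :
    ∫ x, (inner ℝ x (z : EuclideanSpace ℝ (Fin n))) ^ (2 * m) *
        (inner ℝ x (w : EuclideanSpace ℝ (Fin n))) ^ (2 * m) ∂(gaussian n) ≤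
      evenMoment m ^ 2 + (inner ℝ (z : EuclideanSpace ℝ (Fin n)) w) ^ 2 *
        (4 ^ m * evenMoment (2 * m)) := by
  set ρ : ℝ := inner ℝ (z : EuclideanSpace ℝ (Fin n)) w with hρdef
  -- `w = ρ z + v` with `v ⟂ z`, so `⟨x, v⟩` is independent of `⟨x, z⟩` and has variance `1 - ρ² ≤
  -- 1`.
  set v : EuclideanSpace ℝ (Fin n) := (w : EuclideanSpace ℝ (Fin n)) - ρ • (z : _) with hv
  have hρ : |ρ| ≤ 1 := by simpa [norm_coe_sphere] using abs_inner_sphere_le z.1 w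
  have hzv : inner ℝ (z : EuclideanSpace ℝ (Fin n)) v = 0 := by
    rw [hv, inner_sub_right, inner_smul_right, real_inner_self_eq_norm_sq, norm_coe_sphere]
    simp [hρdef]
  have hvn : ‖v‖₊ ^ 2 ≤ 1 := by
    have : ‖v‖ ^ 2 = 1 - ρ ^ 2 := by
      rw [hv, norm_sub_sq_real, inner_smul_right, real_inner_comm, norm_smul, norm_coe_sphere,
        norm_coe_sphere, ← hρdef]
      simp
      ring
    rw [← NNReal.coe_le_coe]
    push_cast
    rw [this]
    nlinarith [sq_nonneg ρ]
  have hexp : ∀ x : EuclideanSpace ℝ (Fin n),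
      (inner ℝ x (z : EuclideanSpace ℝ (Fin n))) ^ (2 * m) *
        (inner ℝ x (w : EuclideanSpace ℝ (Fin n))) ^ (2 * m) =
      ∑ k ∈ Finset.range (2 * m + 1), ((2 * m).choose k * ρ ^ k) *
        ((inner ℝ x (z : EuclideanSpace ℝ (Fin n))) ^ (2 * m + k) *
          (inner ℝ x v) ^ (2 * m - k)) := by
    intro x
    have : (inner ℝ x (w : EuclideanSpace ℝ (Fin n)) : ℝ) =
        ρ * inner ℝ x (z : EuclideanSpace ℝ (Fin n)) + inner ℝ x v := by
      rw [hv, inner_sub_right, inner_smul_right]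
      ring
    rw [this, add_pow, Finset.mul_sum]
    refine Finset.sum_congr rfl fun k _ => ?_
    rw [mul_pow, pow_add]
    ring
  simp_rw [hexp]
  rw [integral_finsetSum _ fun k _ => (integrable_inner_pow_mul_inner_pow hzv _ _).const_mul _]
  simp_rw [integral_const_mul, integral_inner_pow_mul_inner_pow hzv, nnnorm_coe_sphere_sq]
  calc _ ≤ ∑ k ∈ Finset.range (2 * m + 1), ((2 * m).choose k : ℝ) *
          ((if k = 0 then evenMoment m ^ 2 else 0) + ρ ^ 2 * evenMoment (2 * m)) := by
        refine Finset.sum_le_sum fun k hk => ?_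
        rw [mul_assoc]
        gcongr
        exact pow_mul_moment_le hρ hvn (Nat.lt_succ_iff.1 (Finset.mem_range.1 hk))
    _ = _ := by
        simp_rw [mul_add, Finset.sum_add_distrib, mul_ite, mul_zero]
        rw [Finset.sum_ite_eq' , if_pos (by simp), ← Finset.sum_mul]
        -- The factor `4 ^ m` is the sum of the binomial coefficients of order `2m`.
        have h := Nat.sum_range_choose (2 * m)
        rw [pow_mul] at h
        have h' : ∑ k ∈ Finset.range (2 * m + 1), ((2 * m).choose k : ℝ) = 4 ^ m := by
          exact_mod_cast h
        rw [h']
        simp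
        ring

end

/-! ### Gaussian averages and the general bound on the critical dimension. -/

section

variable {n : ℕ} {μ : Measure (UnitSphere n)}

lemma integrable_prod_gaussian_of_le {α : Type*} [TopologicalSpace α] [MeasurableSpace α]
    [OpensMeasurableSpace α] [SecondCountableTopology α] {ν : Measure α} [IsFiniteMeasure ν]
    {F : EuclideanSpace ℝ (Fin n) × α → ℝ} (hF : Continuous F) {q : ℝ} (hq : 0 < q)
    (h : ∀ p, |F p| ≤ ‖p.1‖ ^ q) : Integrable F ((gaussian n).prod ν) := by
  have h1 := (integrable_norm_rpow_gaussian (n := n) hq).mul_prod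
    (integrable_const (1 : ℝ) (μ := ν))
  refine h1.mono hF.aestronglyMeasurable (Filter.Eventually.of_forall fun p => ?_)
  rw [Real.norm_eq_abs, mul_one, Real.norm_of_nonneg (by positivity)]
  exact h p

lemma integrable_abs_inner_rpow_prod [IsFiniteMeasure μ] {q : ℝ} (hq : 0 < q) :
    Integrable (fun p : EuclideanSpace ℝ (Fin n) × UnitSphere n =>
      |inner ℝ p.1 (p.2 : EuclideanSpace ℝ (Fin n))| ^ q) ((gaussian n).prod μ) := by
  refine integrable_prod_gaussian_of_le ((continuous_abs_rpow hq.le).comp (by fun_prop)) hq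
    fun p => ?_
  rw [abs_of_nonneg (by positivity)]
  exact Real.rpow_le_rpow (abs_nonneg _) (abs_inner_sphere_le _ _) hq.le

lemma integrable_bodyNorm_rpow [IsFiniteMeasure μ] {q : ℝ} (hq : 0 < q) :
    Integrable (fun x => bodyNorm μ q x ^ q) (gaussian n) := by
  simp_rw [bodyNorm_rpow hq.ne']
  exact (integrable_abs_inner_rpow_prod hq).integral_prod_left

lemma integral_bodyNorm_rpow [IsFiniteMeasure μ] {q : ℝ} (hq : 0 < q) :
    ∫ x, bodyNorm μ q x ^ q ∂(gaussian n) =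
      (∫ t : ℝ, |t| ^ q ∂(gaussianReal 0 1)) * μ.real Set.univ := by
  simp_rw [bodyNorm_rpow hq.ne']
  rw [integral_integral_swap (integrable_abs_inner_rpow_prod hq)]
  simp_rw [integral_inner_gaussian (continuous_abs_rpow hq.le), nnnorm_coe_sphere_sq]
  simp [mul_comm]

lemma gaussianMoment_rpow {q : ℝ} (hq : q ≠ 0) :
    gaussianMoment q ^ q = ∫ t : ℝ, |t| ^ q ∂(gaussianReal 0 1) := by
  rw [gaussianMoment, ← Real.rpow_mul (integral_nonneg fun _ => by positivity),
    one_div_mul_cancel hq, Real.rpow_one]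

lemma IsIsotropic.integral_norm_sq (hμ : IsIsotropic μ) :
    ∫ x, ‖x‖ ^ 2 ∂(gaussian n) = n := by
  have := hμ.isFiniteMeasure
  have h := integral_bodyNorm_rpow (μ := μ) (q := 2) two_pos
  simp_rw [hμ.bodyNorm_two, Real.rpow_two, sq_abs, hμ.measureReal_univ] at h
  rw [h, ← mul_one 2, integral_pow_even_gaussianReal 1]
  simp [evenMoment]

lemma IsIsotropic.integrable_bodyNorm_sq (hμ : IsIsotropic μ) {q : ℝ} (hq : 1 ≤ q) :
    Integrable (fun x => bodyNorm μ q x ^ 2) (gaussian n) := by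
  have := hμ.isFiniteMeasure
  obtain ⟨C, hC, h⟩ := hμ.bodyNorm_le_const hq
  refine ((integrable_norm_pow_gaussian 2).const_mul (C ^ 2)).mono
    ((continuous_bodyNorm hq).pow 2).aestronglyMeasurable (Filter.Eventually.of_forall fun x => ?_)
  rw [Real.norm_of_nonneg (by positivity), Real.norm_of_nonneg (by positivity), ← mul_pow]
  exact pow_le_pow_left₀ (bodyNorm_nonneg _ _) (h x) 2

/-- An upper bound for the maximum suffices. The condition `n ≥ 1` makes the sphere nonempty and the
maximum positive, so the quotient is genuine. -/
lemma IsIsotropic.le_criticalDim (hμ : IsIsotropic μ) (hn : 1 ≤ n) {q : ℝ} (hq : 1 ≤ q) {A B : ℝ}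
    (hA : 0 ≤ A) (hB : ∀ θ : UnitSphere n, bodyNorm μ q (θ : EuclideanSpace ℝ (Fin n)) ≤ B)
    (h : A * B ^ 2 ≤ ∫ x, bodyNorm μ q x ^ 2 ∂(gaussian n)) :
    A ≤ criticalDim (bodyNorm μ q) := by
  have : Nonempty (UnitSphere n) := by
    refine ⟨⟨EuclideanSpace.single ⟨0, hn⟩ 1, ?_⟩⟩
    simp
  obtain ⟨θ⟩ := this
  have hpos : 0 < maxOnSphere (bodyNorm μ q) := by
    refine (hμ.bodyNorm_pos hn hq (x := θ) ?_).trans_le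
      (le_ciSup (f := fun θ : UnitSphere n => bodyNorm μ q (θ : EuclideanSpace ℝ (Fin n)))
        ⟨B, Set.forall_mem_range.2 hB⟩ θ)
    rw [← norm_ne_zero_iff, norm_coe_sphere]
    exact one_ne_zero
  have : Nonempty (UnitSphere n) := ⟨θ⟩
  have hle : maxOnSphere (bodyNorm μ q) ≤ B := ciSup_le hB
  rw [criticalDim, le_div_iff₀ (by positivity)]
  exact le_trans (by gcongr) h

lemma integral_abs_gaussianReal_pos : 0 < ∫ t : ℝ, |t| ∂(gaussianReal 0 1) := by
  have hi : Integrable (fun t : ℝ => |t|) (gaussianReal 0 1) := by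
    simpa using integrable_abs_rpow_gaussianReal one_pos 1
  rw [integral_pos_iff_support_of_nonneg (fun t => abs_nonneg t) hi]
  have := nullSingletonClass_gaussianReal (μ := 0) (v := 1) one_ne_zero
  have hs : Function.support (fun t : ℝ => |t|) = {0}ᶜ := by ext; simp
  rw [hs, prob_compl_eq_one_sub (measurableSet_singleton 0)]
  simp

/-- Hölder, squared and averaged: the device for moving Gaussian estimates between exponents. -/
lemma IsIsotropic.integral_bodyNorm_sq_ge_of_le (hμ : IsIsotropic μ) (hn : 1 ≤ n) {p q : ℝ}
    (hp : 1 ≤ p) (hpq : p ≤ q) :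
    (n : ℝ) ^ (2 / q - 2 / p) * ∫ x, bodyNorm μ p x ^ 2 ∂(gaussian n) ≤
      ∫ x, bodyNorm μ q x ^ 2 ∂(gaussian n) := by
  have hn' : (0 : ℝ) < n := by exact_mod_cast hn
  rw [← integral_const_mul]
  refine integral_mono ((hμ.integrable_bodyNorm_sq hp).const_mul _)
    (hμ.integrable_bodyNorm_sq (hp.trans hpq)) fun x => ?_
  have h := pow_le_pow_left₀ (bodyNorm_nonneg _ _) (hμ.bodyNorm_le hp hpq x) 2
  rw [mul_pow, ← Real.rpow_mul_natCast hn'.le] at h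
  calc (n : ℝ) ^ (2 / q - 2 / p) * bodyNorm μ p x ^ 2
      ≤ (n : ℝ) ^ (2 / q - 2 / p) *
          ((n : ℝ) ^ ((1 / p - 1 / q) * (2 : ℕ)) * bodyNorm μ q x ^ 2) := by gcongr
    _ = bodyNorm μ q x ^ 2 := by
      rw [← mul_assoc, ← Real.rpow_add hn']
      push_cast
      rw [show 2 / q - 2 / p + (1 / p - 1 / q) * 2 = 0 by ring, Real.rpow_zero, one_mul]

lemma IsIsotropic.sq_integral_bodyNorm_one_le (hμ : IsIsotropic μ) :
    ((∫ t : ℝ, |t| ∂(gaussianReal 0 1)) * n) ^ 2 ≤ ∫ x, bodyNorm μ 1 x ^ 2 ∂(gaussian n) := by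
  have := hμ.isFiniteMeasure
  have h := integral_bodyNorm_rpow (μ := μ) (q := 1) one_pos
  simp_rw [Real.rpow_one, hμ.measureReal_univ] at h
  rw [← h]
  have hL : MemLp (bodyNorm μ 1) 2 (gaussian n) :=
    (memLp_two_iff_integrable_sq (continuous_bodyNorm le_rfl).aestronglyMeasurable).2
      (hμ.integrable_bodyNorm_sq le_rfl)
  -- `(E N)² ≤ E N²`, by nonnegativity of the variance.
  have := variance_nonneg (bodyNorm μ 1) (gaussian n)
  rw [variance_eq_sub hL] at this
  simpa using this

/-- For `q ≤ 2`, the mean is at least `n^(2/q-2) (n E|g₁|)²` and the squared maximum at most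
`n^(2/q-1)`. For `q ≥ 2`, the mean is at least `n^(2/q-1) n` and the maximum at most 1. -/
theorem IsIsotropic.rpow_le_criticalDim (hμ : IsIsotropic μ) (hn : 1 ≤ n) {q : ℝ} (hq : 1 ≤ q) :
    min 1 ((∫ t : ℝ, |t| ∂(gaussianReal 0 1)) ^ 2) * (n : ℝ) ^ (min 1 (2 / q)) ≤
      criticalDim (bodyNorm μ q) := by
  have hn' : (0 : ℝ) < n := by exact_mod_cast hn
  have hq0 : 0 < q := by linarith
  rcases le_total q 2 with h2 | h2
  · rw [min_eq_left ((one_le_div hq0).2 h2), Real.rpow_one]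
    refine le_trans (mul_le_mul_of_nonneg_right (min_le_right _ _) hn'.le)
      (hμ.le_criticalDim hn hq (B := (n : ℝ) ^ (1 / q - 1 / 2)) (by positivity) (fun θ => ?_) ?_)
    · have := hμ.bodyNorm_le hq h2 (θ : EuclideanSpace ℝ (Fin n))
      rwa [hμ.bodyNorm_two, norm_coe_sphere, mul_one] at this
    · refine le_trans ?_ (hμ.integral_bodyNorm_sq_ge_of_le hn le_rfl hq)
      refine le_trans ?_ (mul_le_mul_of_nonneg_left hμ.sq_integral_bodyNorm_one_le (by positivity))
      refine le_of_eq ?_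
      rw [mul_pow, mul_left_comm, mul_assoc, ← Real.rpow_mul_natCast hn'.le]
      congr 1
      rw [← Real.rpow_natCast (n : ℝ) 2, ← Real.rpow_add hn', ← Real.rpow_one_add' hn'.le]
      · congr 1; push_cast; ring
      · push_cast; field_simp; positivity
  · rw [min_eq_right ((div_le_one hq0).2 h2)]
    refine le_trans (mul_le_mul_of_nonneg_right (min_le_left _ _) (by positivity))
      (hμ.le_criticalDim hn hq (B := 1) (by positivity) (fun θ => ?_) ?_)
    · simpa [norm_coe_sphere] using hμ.bodyNorm_le_norm h2 (θ : EuclideanSpace ℝ (Fin n))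
    · refine le_trans (le_of_eq ?_) (hμ.integral_bodyNorm_sq_ge_of_le hn one_le_two h2)
      simp_rw [hμ.bodyNorm_two, hμ.integral_norm_sq]
      rw [div_self two_ne_zero, Real.rpow_sub_one hn'.ne']
      field

end

/-! ### Second moment method for even exponents. -/

section

variable {n : ℕ} {μ : Measure (UnitSphere n)}

/-- The even power `‖x‖_{B_{2m}(μ)}^{2m}` as an integral of a natural power. -/
noncomputable def evenPower (μ : Measure (UnitSphere n)) (m : ℕ) (x : EuclideanSpace ℝ (Fin n)) : ℝ :=
  ∫ z : UnitSphere n, (inner ℝ x (z : EuclideanSpace ℝ (Fin n))) ^ (2 * m) ∂μ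

lemma evenPower_nonneg (m : ℕ) (x : EuclideanSpace ℝ (Fin n)) : 0 ≤ evenPower μ m x :=
  integral_nonneg fun z => by simp only [pow_mul]; positivity

lemma abs_rpow_two_mul (m : ℕ) (t : ℝ) : |t| ^ (2 * m : ℝ) = t ^ (2 * m) := by
  rw [← Nat.cast_ofNat, ← Nat.cast_mul, Real.rpow_natCast, pow_mul, sq_abs, pow_mul]

lemma bodyNorm_two_mul_sq (m : ℕ) (x : EuclideanSpace ℝ (Fin n)) :
    bodyNorm μ (2 * m) x ^ 2 = evenPower μ m x ^ (1 / m : ℝ) := by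
  simp_rw [bodyNorm, abs_rpow_two_mul]
  rw [← evenPower, ← Real.rpow_mul_natCast (evenPower_nonneg _ _)]
  congr 1
  push_cast
  field

lemma evenPower_eq {m : ℕ} (hm : 1 ≤ m) (x : EuclideanSpace ℝ (Fin n)) :
    evenPower μ m x = bodyNorm μ (2 * m) x ^ (2 * m : ℝ) := by
  rw [bodyNorm_rpow (by positivity)]
  simp_rw [abs_rpow_two_mul]
  rfl

lemma integrable_evenPower [IsFiniteMeasure μ] {m : ℕ} (hm : 1 ≤ m) :
    Integrable (evenPower μ m) (gaussian n) := by
  refine (integrable_bodyNorm_rpow (μ := μ) (q := 2 * m) (by positivity)).congr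
    (Filter.Eventually.of_forall fun x => ?_)
  exact (evenPower_eq hm x).symm

lemma IsIsotropic.integral_evenPower (hμ : IsIsotropic μ) {m : ℕ} (hm : 1 ≤ m) :
    ∫ x, evenPower μ m x ∂(gaussian n) = evenMoment m * n := by
  have := hμ.isFiniteMeasure
  simp_rw [evenPower_eq hm]
  rw [integral_bodyNorm_rpow (by positivity), hμ.measureReal_univ]
  simp_rw [abs_rpow_two_mul, integral_pow_even_gaussianReal]

lemma integrable_evenPower_kernel [IsFiniteMeasure μ] {m : ℕ} (hm : 1 ≤ m) :
    Integrable (fun p : EuclideanSpace ℝ (Fin n) × (UnitSphere n × UnitSphere n) =>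
      (inner ℝ p.1 (p.2.1 : EuclideanSpace ℝ (Fin n))) ^ (2 * m) *
        (inner ℝ p.1 (p.2.2 : EuclideanSpace ℝ (Fin n))) ^ (2 * m))
      ((gaussian n).prod (μ.prod μ)) := by
  refine integrable_prod_gaussian_of_le (by fun_prop) (q := (4 * m : ℕ))
    (by exact_mod_cast (by omega : 0 < 4 * m)) fun p => ?_
  rw [abs_mul, abs_pow, abs_pow, Real.rpow_natCast, show 4 * m = 2 * m + 2 * m by ring, pow_add]
  gcongr <;> exact abs_inner_sphere_le _ _

lemma evenPower_sq [IsFiniteMeasure μ] (m : ℕ) (x : EuclideanSpace ℝ (Fin n)) :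
    evenPower μ m x ^ 2 = ∫ p : UnitSphere n × UnitSphere n,
      (inner ℝ x (p.1 : EuclideanSpace ℝ (Fin n))) ^ (2 * m) *
        (inner ℝ x (p.2 : EuclideanSpace ℝ (Fin n))) ^ (2 * m) ∂(μ.prod μ) := by
  rw [integral_prod_mul (fun z : UnitSphere n => (inner ℝ x (z : EuclideanSpace ℝ (Fin n))) ^ (2 * m))
    (fun z : UnitSphere n => (inner ℝ x (z : EuclideanSpace ℝ (Fin n))) ^ (2 * m)), sq]
  rfl

lemma integrable_evenPower_sq [IsFiniteMeasure μ] {m : ℕ} (hm : 1 ≤ m) :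
    Integrable (fun x => evenPower μ m x ^ 2) (gaussian n) := by
  simp_rw [evenPower_sq]
  exact (integrable_evenPower_kernel hm).integral_prod_left

lemma integrable_inner_sq_prod [IsFiniteMeasure μ] :
    Integrable (fun p : UnitSphere n × UnitSphere n =>
      (inner ℝ (p.1 : EuclideanSpace ℝ (Fin n)) p.2) ^ 2) (μ.prod μ) :=
  (by fun_prop : Continuous fun p : UnitSphere n × UnitSphere n =>
      (inner ℝ (p.1 : EuclideanSpace ℝ (Fin n)) p.2) ^ 2).integrable_of_hasCompactSupport
    (HasCompactSupport.of_compactSpace _)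

/-- Isotropy at each unit `z` makes the inner integral 1. The result `n`, not `n²`, makes
correlations negligible on average. -/
lemma IsIsotropic.integral_inner_sq_prod (hμ : IsIsotropic μ) [IsFiniteMeasure μ] :
    ∫ p : UnitSphere n × UnitSphere n, (inner ℝ (p.1 : EuclideanSpace ℝ (Fin n)) p.2) ^ 2
      ∂(μ.prod μ) = n := by
  rw [integral_prod _ integrable_inner_sq_prod]
  have h : ∀ z : UnitSphere n, ∫ w : UnitSphere n,
      (inner ℝ (z : EuclideanSpace ℝ (Fin n)) w) ^ 2 ∂μ = 1 := fun z => by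
    have := hμ z
    simp_rw [sq_abs] at this
    rw [← this, norm_coe_sphere, one_pow]
  simp_rw [h]
  simp [hμ.measureReal_univ]

lemma IsIsotropic.integral_evenPower_sq_le (hμ : IsIsotropic μ) {m : ℕ} (hm : 1 ≤ m)
    (hmn : (16 : ℝ) ^ m ≤ n) :
    ∫ x, evenPower μ m x ^ 2 ∂(gaussian n) ≤ 2 * (evenMoment m * n) ^ 2 := by
  have := hμ.isFiniteMeasure
  simp_rw [evenPower_sq]
  rw [integral_integral_swap (integrable_evenPower_kernel hm)]
  calc _ ≤ ∫ p : UnitSphere n × UnitSphere n, (evenMoment m ^ 2 +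
        (inner ℝ (p.1 : EuclideanSpace ℝ (Fin n)) p.2) ^ 2 * (4 ^ m * evenMoment (2 * m)))
          ∂(μ.prod μ) := by
        refine integral_mono (integrable_evenPower_kernel hm).integral_prod_right
          ((integrable_const _).add (integrable_inner_sq_prod.mul_const _)) fun p => ?_
        exact integral_inner_pow_even_mul_le p.1 p.2 m
    _ = n ^ 2 * evenMoment m ^ 2 + n * (4 ^ m * evenMoment (2 * m)) := by
        rw [integral_add (integrable_const _) (integrable_inner_sq_prod.mul_const _),
          integral_mul_const, hμ.integral_inner_sq_prod]
        simp [measureReal_prod_prod, ← Set.univ_prod_univ, hμ.measureReal_univ, sq]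
    _ ≤ n ^ 2 * evenMoment m ^ 2 + n * (4 ^ m * (4 ^ m * evenMoment m ^ 2)) := by
        gcongr
        exact evenMoment_two_mul_le m
    _ = n ^ 2 * evenMoment m ^ 2 + n * (16 ^ m * evenMoment m ^ 2) := by
        rw [← mul_assoc (4 ^ m : ℝ), ← mul_pow (4 : ℝ) 4 m]; norm_num
    -- The correlation term is absorbed here: `16 ^ m ≤ n` bounds it by the main term.
    _ ≤ n ^ 2 * evenMoment m ^ 2 + n * (n * evenMoment m ^ 2) := by gcongr
    _ = _ := by ring

end

/-- Stands in for Paley-Zygmund: with `y = Y / E Y` and `E y² ≤ 2`, averaging gives `E y^a ≥ 1/2`.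
For `y ≥ 1` the left side is at most `1` because `(y/2 - 1)² ≥ 0`. -/
lemma sub_sq_div_four_le_rpow {y a : ℝ} (hy : 0 ≤ y) (ha : 0 ≤ a) (ha1 : a ≤ 1) :
    y - y ^ 2 / 4 ≤ y ^ a := by
  rcases le_total y 1 with h | h
  · have : y ^ (1 : ℝ) ≤ y ^ a := by
      rcases hy.eq_or_lt with rfl | hy
      · rw [Real.zero_rpow one_ne_zero]; positivity
      · exact Real.rpow_le_rpow_of_exponent_ge hy h ha1
    rw [Real.rpow_one] at this
    nlinarith [sq_nonneg y]
  · have := Real.one_le_rpow h ha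
    nlinarith [sq_nonneg (y / 2 - 1)]

lemma rpow_le_one_add {y a : ℝ} (hy : 0 ≤ y) (ha : 0 ≤ a) (ha1 : a ≤ 1) : y ^ a ≤ 1 + y := by
  rcases le_total y 1 with h | h
  · linarith [Real.rpow_le_one hy h ha]
  · have := Real.rpow_le_rpow_of_exponent_le h ha1
    rw [Real.rpow_one] at this
    linarith

/-! ### Sharp order of the Gaussian mean for `2 ≤ q ≤ c log n`. -/

section

variable {n : ℕ} {μ : Measure (UnitSphere n)}

lemma IsIsotropic.le_integral_bodyNorm_two_mul_sq (hμ : IsIsotropic μ) (hn : 1 ≤ n) {m : ℕ}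
    (hm : 1 ≤ m) (hmn : (16 : ℝ) ^ m ≤ n) :
    (evenMoment m * n) ^ (1 / m : ℝ) / 2 ≤ ∫ x, bodyNorm μ (2 * m) x ^ 2 ∂(gaussian n) := by
  have := hμ.isFiniteMeasure
  have hn' : (0 : ℝ) < n := by exact_mod_cast hn
  have hm' : (1 : ℝ) ≤ m := by exact_mod_cast hm
  set M : ℝ := evenMoment m * n with hM
  have hM0 : 0 < M := mul_pos (evenMoment_pos m) hn'
  have hint : Integrable (fun x => M ^ (1 / m : ℝ) * (evenPower μ m x / M -
      evenPower μ m x ^ 2 / (4 * M ^ 2))) (gaussian n) :=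
    (((integrable_evenPower hm).div_const _).sub
      ((integrable_evenPower_sq hm).div_const _)).const_mul _
  calc M ^ (1 / m : ℝ) / 2
      ≤ M ^ (1 / m : ℝ) * (M / M - (∫ x, evenPower μ m x ^ 2 ∂(gaussian n)) / (4 * M ^ 2)) := by
        rw [div_eq_mul_inv]
        have h := hμ.integral_evenPower_sq_le hm hmn
        have h2 : (∫ x, evenPower μ m x ^ 2 ∂(gaussian n)) / (4 * M ^ 2) ≤ 1 / 2 := by
          rw [div_le_iff₀ (by positivity)]
          linarith
        gcongr
        rw [div_self hM0.ne']
        linarith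
    _ = ∫ x, M ^ (1 / m : ℝ) * (evenPower μ m x / M - evenPower μ m x ^ 2 / (4 * M ^ 2))
          ∂(gaussian n) := by
        rw [integral_const_mul, integral_sub ((integrable_evenPower hm).div_const _)
          ((integrable_evenPower_sq hm).div_const _), integral_div, integral_div,
          hμ.integral_evenPower hm]
    _ ≤ _ := by
        refine integral_mono hint (hμ.integrable_bodyNorm_sq (by linarith)) fun x => ?_
        simp only
        rw [bodyNorm_two_mul_sq]
        have hY := evenPower_nonneg (μ := μ) m x
        have h := sub_sq_div_four_le_rpow (div_nonneg hY hM0.le) (a := 1 / m) (by positivity)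
          ((div_le_one (by positivity)).2 hm')
        rw [Real.div_rpow hY hM0.le, le_div_iff₀ (by positivity)] at h
        refine le_trans (le_of_eq ?_) h
        field

lemma IsIsotropic.integral_bodyNorm_two_mul_sq_le (hμ : IsIsotropic μ) (hn : 1 ≤ n) {m : ℕ}
    (hm : 1 ≤ m) :
    ∫ x, bodyNorm μ (2 * m) x ^ 2 ∂(gaussian n) ≤ 2 * (evenMoment m * n) ^ (1 / m : ℝ) := by
  have := hμ.isFiniteMeasure
  have hn' : (0 : ℝ) < n := by exact_mod_cast hn
  have hm' : (1 : ℝ) ≤ m := by exact_mod_cast hm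
  set M : ℝ := evenMoment m * n with hM
  have hM0 : 0 < M := mul_pos (evenMoment_pos m) hn'
  have hint : Integrable (fun x => M ^ (1 / m : ℝ) * (1 + evenPower μ m x / M)) (gaussian n) :=
    ((integrable_const _).add ((integrable_evenPower hm).div_const _)).const_mul _
  calc ∫ x, bodyNorm μ (2 * m) x ^ 2 ∂(gaussian n)
      ≤ ∫ x, M ^ (1 / m : ℝ) * (1 + evenPower μ m x / M) ∂(gaussian n) := by
        refine integral_mono (hμ.integrable_bodyNorm_sq (by linarith)) hint fun x => ?_
        simp only
        rw [bodyNorm_two_mul_sq]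
        have hY := evenPower_nonneg (μ := μ) m x
        have h := rpow_le_one_add (div_nonneg hY hM0.le) (a := 1 / m) (by positivity)
          ((div_le_one (by positivity)).2 hm')
        rw [Real.div_rpow hY hM0.le, div_le_iff₀ (by positivity)] at h
        linarith
    _ = _ := by
        rw [integral_const_mul, integral_add (integrable_const _)
          ((integrable_evenPower hm).div_const _), integral_div, hμ.integral_evenPower hm,
          div_self hM0.ne']
        simp
        ring

lemma evenMoment_rpow_le {m : ℕ} (hm : 1 ≤ m) : evenMoment m ^ (1 / m : ℝ) ≤ 2 * m := by
  have hm' : (0 : ℝ) < m := by exact_mod_cast hm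
  calc evenMoment m ^ (1 / m : ℝ) ≤ ((2 * (m : ℝ)) ^ m) ^ (1 / m : ℝ) :=
        Real.rpow_le_rpow (evenMoment_pos m).le (evenMoment_le_pow m) (by positivity)
    _ = 2 * m := by
        rw [one_div, Real.pow_rpow_inv_natCast (by positivity) (by omega)]

lemma le_evenMoment_rpow {m : ℕ} (hm : 1 ≤ m) : (m : ℝ) / 3 ≤ evenMoment m ^ (1 / m : ℝ) := by
  have hm' : (0 : ℝ) < m := by exact_mod_cast hm
  calc (m : ℝ) / 3 = (((m : ℝ) / 3) ^ m) ^ (1 / m : ℝ) := by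
        rw [one_div, Real.pow_rpow_inv_natCast (by positivity) (by omega)]
    _ ≤ evenMoment m ^ (1 / m : ℝ) :=
        Real.rpow_le_rpow (by positivity) (pow_le_evenMoment m) (by positivity)

lemma IsIsotropic.integral_bodyNorm_sq_le (hμ : IsIsotropic μ) (hn : 1 ≤ n) {q : ℝ} (hq : 2 ≤ q) :
    ∫ x, bodyNorm μ q x ^ 2 ∂(gaussian n) ≤ 4 * q * (n : ℝ) ^ (2 / q) := by
  have hn' : (0 : ℝ) < n := by exact_mod_cast hn
  -- Rounding up makes Hölder give an upper bound; `m ≤ q` since `q ≥ 2`.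
  set m : ℕ := ⌈q / 2⌉₊ with hmdef
  have hm1 : q ≤ 2 * m := by linarith [Nat.le_ceil (q / 2)]
  have hm2 : (m : ℝ) ≤ q := by linarith [Nat.ceil_lt_add_one (a := q / 2) (by linarith)]
  have hm : 1 ≤ m := Nat.ceil_pos.2 (by linarith)
  have hm' : (0 : ℝ) < m := by exact_mod_cast hm
  have h1 := hμ.integral_bodyNorm_sq_ge_of_le hn (by linarith : 1 ≤ q) hm1
  have h2 := h1.trans (hμ.integral_bodyNorm_two_mul_sq_le hn hm)
  rw [Real.mul_rpow (evenMoment_pos m).le hn'.le, show 2 / (2 * m : ℝ) = 1 / m by field,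
    Real.rpow_sub hn', div_mul_eq_mul_div, div_le_iff₀ (by positivity)] at h2
  have h3 : 2 * (evenMoment m ^ (1 / m : ℝ) * (n : ℝ) ^ (1 / m : ℝ)) * (n : ℝ) ^ (2 / q) ≤
      (n : ℝ) ^ (1 / m : ℝ) * (4 * q * (n : ℝ) ^ (2 / q)) := by
    have := (evenMoment_rpow_le hm).trans (mul_le_mul_of_nonneg_left hm2 two_pos.le)
    calc _ = (n : ℝ) ^ (1 / m : ℝ) * (2 * evenMoment m ^ (1 / m : ℝ) * (n : ℝ) ^ (2 / q)) := by ring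
      _ ≤ (n : ℝ) ^ (1 / m : ℝ) * (2 * (2 * q) * (n : ℝ) ^ (2 / q)) := by gcongr
      _ = _ := by ring
  exact le_of_mul_le_mul_left (h2.trans h3) (by positivity)

lemma IsIsotropic.le_integral_bodyNorm_sq (hμ : IsIsotropic μ) (hn : 1 ≤ n) {q : ℝ} (hq : 2 ≤ q)
    (hqn : q ≤ 1 / 2 * Real.log n) :
    q / 24 * (n : ℝ) ^ (2 / q) ≤ ∫ x, bodyNorm μ q x ^ 2 ∂(gaussian n) := by
  have hn' : (0 : ℝ) < n := by exact_mod_cast hn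
  -- Rounding down makes Hölder give a lower bound; `m ≥ q / 4` since `m ≥ 1`.
  set m : ℕ := ⌊q / 2⌋₊ with hmdef
  have hm1 : 2 * m ≤ q := by linarith [Nat.floor_le (a := q / 2) (by linarith)]
  have hm : 1 ≤ m := (Nat.one_le_floor_iff _).2 (by linarith)
  have hm' : (1 : ℝ) ≤ m := by exact_mod_cast hm
  have hm2 : q / 4 ≤ m := by linarith [Nat.lt_floor_add_one (q / 2)]
  -- Source of the constant `1 / 2`: `16 ≤ e⁴` and `4m ≤ 2q ≤ log n`.
  have hmn : (16 : ℝ) ^ m ≤ n := by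
    have h4 : Real.exp 1 ^ 4 ≥ 16 := by
      have : (2 : ℝ) ≤ Real.exp 1 := by linarith [Real.add_one_le_exp 1]
      calc (16 : ℝ) = 2 ^ 4 := by norm_num
        _ ≤ _ := by gcongr
    calc (16 : ℝ) ^ m ≤ (Real.exp 1 ^ 4) ^ m := by gcongr
      _ = Real.exp (4 * m) := by rw [Real.exp_one_pow, ← Real.exp_nat_mul]; push_cast; ring_nf
      _ ≤ Real.exp (Real.log n) := Real.exp_le_exp.2 (by linarith)
      _ = n := Real.exp_log hn'
  have h1 := hμ.integral_bodyNorm_sq_ge_of_le hn (by linarith : (1 : ℝ) ≤ 2 * m) hm1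
  have h2 := hμ.le_integral_bodyNorm_two_mul_sq hn hm hmn
  refine le_trans ?_ (le_trans (mul_le_mul_of_nonneg_left h2 (by positivity)) h1)
  rw [Real.mul_rpow (evenMoment_pos m).le hn'.le, show 2 / (2 * m : ℝ) = 1 / m by field,
    Real.rpow_sub hn']
  have h3 : q / 12 ≤ evenMoment m ^ (1 / m : ℝ) := by linarith [le_evenMoment_rpow hm]
  calc q / 24 * (n : ℝ) ^ (2 / q) = q / 12 * ((n : ℝ) ^ (2 / q) / 2) := by ring
    _ ≤ evenMoment m ^ (1 / m : ℝ) * ((n : ℝ) ^ (2 / q) / 2) := by gcongr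
    _ = _ := by field

theorem IsIsotropic.integral_bodyNorm_sq_rpow_bounds (hμ : IsIsotropic μ) (hn : 1 ≤ n) {q : ℝ}
    (hq : 2 ≤ q) (hqn : q ≤ 1 / 2 * Real.log n) :
    (1 / 24 : ℝ) ^ (1 / 2 : ℝ) * (q ^ (1 / 2 : ℝ) * (n : ℝ) ^ (1 / q)) ≤
        (∫ x, bodyNorm μ q x ^ 2 ∂(gaussian n)) ^ (1 / 2 : ℝ) ∧
      (∫ x, bodyNorm μ q x ^ 2 ∂(gaussian n)) ^ (1 / 2 : ℝ) ≤
        (4 : ℝ) ^ (1 / 2 : ℝ) * (q ^ (1 / 2 : ℝ) * (n : ℝ) ^ (1 / q)) ∧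
      1 / 24 * q * (n : ℝ) ^ (2 / q) ≤ criticalDim (bodyNorm μ q) := by
  have hn' : (0 : ℝ) < n := by exact_mod_cast hn
  have hroot : ∀ c : ℝ, 0 ≤ c → c ^ (1 / 2 : ℝ) * (q ^ (1 / 2 : ℝ) * (n : ℝ) ^ (1 / q)) =
      (c * q * (n : ℝ) ^ (2 / q)) ^ (1 / 2 : ℝ) := fun c hc => by
    rw [Real.mul_rpow (by positivity) (by positivity), Real.mul_rpow hc (by positivity),
      ← Real.rpow_mul hn'.le, mul_assoc]
    congr 3
    field
  have hlow : 1 / 24 * q * (n : ℝ) ^ (2 / q) ≤ ∫ x, bodyNorm μ q x ^ 2 ∂(gaussian n) :=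
    (le_of_eq (by ring)).trans (hμ.le_integral_bodyNorm_sq hn hq hqn)
  refine ⟨?_, ?_, ?_⟩
  · rw [hroot _ (by norm_num)]
    exact Real.rpow_le_rpow (by positivity) hlow (by norm_num)
  · rw [hroot _ (by norm_num)]
    exact Real.rpow_le_rpow (integral_nonneg fun _ => by positivity)
      (hμ.integral_bodyNorm_sq_le hn hq) (by norm_num)
  · refine hμ.le_criticalDim hn (by linarith) (B := 1) (by positivity) (fun θ => ?_) (by simpa using hlow)
    simpa [norm_coe_sphere] using hμ.bodyNorm_le_norm hq (θ : EuclideanSpace ℝ (Fin n))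

end

/-! ### Monotone transport on the line. -/

section Transport

open Set Filter Topology

lemma hasDerivAt_integral_Iic {f : ℝ → ℝ} (hf : Continuous f) (hi : Integrable f) (t : ℝ) :
    HasDerivAt (fun s => ∫ x in Iic s, f x) (f t) t := by
  have h : ∀ s, ∫ x in Iic s, f x = (∫ x in Iic 0, f x) + ∫ x in (0 : ℝ)..s, f x := fun s => by
    rw [← intervalIntegral.integral_Iic_sub_Iic hi.integrableOn hi.integrableOn]
    ring
  rw [funext h]
  exact (intervalIntegral.integral_hasDerivAt_right (hf.intervalIntegrable _ _)
    (hf.stronglyMeasurableAtFilter _ _) hf.continuousAt).const_add _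

lemma strictMono_integral_Iic {f : ℝ → ℝ} (hf : Continuous f) (hi : Integrable f)
    (hpos : ∀ t, 0 < f t) : StrictMono fun s => ∫ x in Iic s, f x :=
  strictMono_of_hasDerivAt_pos (hasDerivAt_integral_Iic hf hi) hpos

lemma tendsto_integral_Iic_atTop {f : ℝ → ℝ} (hi : Integrable f) :
    Tendsto (fun s => ∫ x in Iic s, f x) atTop (𝓝 (∫ x, f x)) := by
  have := (aecover_Iic (μ := volume) (tendsto_id (α := ℝ))).integral_tendsto_of_countably_generated hi
  exact this

lemma range_integral_Iic {f : ℝ → ℝ} (hf : Continuous f) (hi : Integrable f)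
    (hpos : ∀ t, 0 < f t) : range (fun s => ∫ x in Iic s, f x) = Ioo 0 (∫ x, f x) := by
  have hmono := strictMono_integral_Iic hf hi hpos
  have hcont : Continuous fun s => ∫ x in Iic s, f x :=
    continuous_iff_continuousAt.2 fun t => (hasDerivAt_integral_Iic hf hi t).continuousAt
  have hbot : Tendsto (fun s => ∫ x in Iic s, f x) atBot (𝓝 0) :=
    tendsto_integral_Iic_zero tendsto_id
  have htop := tendsto_integral_Iic_atTop hi
  ext y
  constructor
  · rintro ⟨t, rfl⟩
    exact ⟨(hmono.monotone.le_of_tendsto hbot (t - 1)).trans_lt (hmono (by linarith)),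
      (hmono (by linarith : t < t + 1)).trans_le (hmono.monotone.ge_of_tendsto htop (t + 1))⟩
  · rintro ⟨h0, h1⟩
    exact mem_range_of_exists_le_of_exists_ge hcont
      ((hbot.eventually (eventually_le_nhds h0)).exists)
      ((htop.eventually (eventually_ge_nhds h1)).exists)

/-- Two positive continuous integrable densities with the same mass are transported to each other
by an increasing `C¹` map. -/
lemma exists_transport {f g : ℝ → ℝ} (hf : Continuous f) (hg : Continuous g)
    (hfi : Integrable f) (hgi : Integrable g) (hfpos : ∀ t, 0 < f t) (hgpos : ∀ t, 0 < g t)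
    (hfg : ∫ t, f t = ∫ t, g t) :
    ∃ T T' : ℝ → ℝ, (∀ t, HasDerivAt T (T' t) t) ∧ Continuous T' ∧ (∀ t, 0 < T' t) ∧
      ∀ t, f t = g (T t) * T' t := by
  set F : ℝ → ℝ := fun s => ∫ x in Iic s, f x with hF
  set G : ℝ → ℝ := fun s => ∫ x in Iic s, g x with hG
  have hGmono : StrictMono G := strictMono_integral_Iic hg hgi hgpos
  -- Equal masses give equal ranges, so `G⁻¹ ∘ F` is defined everywhere and the default value of
  -- `invFun` off `range G` is never used.
  have hFr : range F = range G := by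
    rw [hF, hG, range_integral_Iic hf hfi hfpos, range_integral_Iic hg hgi hgpos, hfg]
  have hopen : IsOpen (range G) := by
    rw [hG, range_integral_Iic hg hgi hgpos]; exact isOpen_Ioo
  set I : ℝ → ℝ := Function.invFun G with hI
  have hIG : ∀ t, I (G t) = t := Function.leftInverse_invFun hGmono.injective
  have hGI : ∀ y ∈ range G, G (I y) = y := by
    rintro _ ⟨t, rfl⟩
    rw [hIG]
  have hImono : StrictMonoOn I (range G) := by
    rintro _ ⟨a, rfl⟩ _ ⟨b, rfl⟩ hab
    rw [hIG, hIG]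
    exact hGmono.lt_iff_lt.1 hab
  have himage : I '' range G = univ :=
    eq_univ_of_forall fun t => ⟨G t, mem_range_self t, hIG t⟩
  have hIder : ∀ y ∈ range G, HasDerivAt I (g (I y))⁻¹ y := fun y hy =>
    HasDerivAt.of_local_left_inverse
      (hImono.continuousAt_of_image_mem_nhds (hopen.mem_nhds hy) (by rw [himage]; exact univ_mem))
      (hasDerivAt_integral_Iic hg hgi _) (hgpos _).ne'
      (eventually_of_mem (hopen.mem_nhds hy) hGI)
  have hT : ∀ t, HasDerivAt (I ∘ F) ((g (I (F t)))⁻¹ * f t) t := fun t =>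
    (hIder (F t) (hFr ▸ mem_range_self t)).comp t (hasDerivAt_integral_Iic hf hfi t)
  have hTc : Continuous (I ∘ F) := continuous_iff_continuousAt.2 fun t => (hT t).continuousAt
  refine ⟨I ∘ F, fun t => (g (I (F t)))⁻¹ * f t, hT, ?_, fun t => ?_, fun t => ?_⟩
  · exact ((hg.comp hTc).inv₀ fun t => (hgpos _).ne').mul hf
  · exact mul_pos (inv_pos.2 (hgpos _)) (hfpos t)
  · simp [(hgpos (I (F t))).ne']

lemma exists_gaussian_transport {f : ℝ → ℝ} (hf : Continuous f) (hfi : Integrable f)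
    (hfpos : ∀ t, 0 < f t) :
    ∃ T T' : ℝ → ℝ, (∀ t, HasDerivAt T (T' t) t) ∧ Continuous T' ∧ (∀ t, 0 < T' t) ∧
      ∀ t, f t = (∫ s, f s) * Real.exp (-Real.pi * T t ^ 2) * T' t := by
  have hc : 0 < ∫ s, f s := by
    rw [integral_pos_iff_support_of_nonneg (fun t => (hfpos t).le) hfi]
    have : Function.support f = univ := eq_univ_of_forall fun t => (hfpos t).ne'
    simp [this]
  refine exists_transport hf (g := fun t => (∫ s, f s) * Real.exp (-Real.pi * t ^ 2))
    (by fun_prop) hfi ((integrable_exp_neg_mul_sq Real.pi_pos).const_mul _) hfpos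
    (fun t => by positivity) ?_
  rw [integral_const_mul, integral_gaussian, div_self Real.pi_ne_zero, Real.sqrt_one, mul_one]

end Transport

/-! ### Geometric Brascamp-Lieb inequality and volumes. -/

section BrascampLieb

variable {n : ℕ} {μ : Measure (UnitSphere n)}

/-- Diagonalise `A` in an orthonormal basis `b i`. Each `⟨b i, z⟩² dμ` is a probability measure
under which `w` has mean the eigenvalue `l i`; apply Jensen for `log` and sum, using `∑ ⟨b i, z⟩² =
1`. -/
lemma IsIsotropic.exp_integral_log_le_det (hμ : IsIsotropic μ) {w : UnitSphere n → ℝ}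
    (hw : Continuous w) (hpos : ∀ z, 0 < w z)
    {A : EuclideanSpace ℝ (Fin n) →L[ℝ] EuclideanSpace ℝ (Fin n)}
    (hA : ∀ u v, inner ℝ (A u) v = ∫ z : UnitSphere n, w z *
      (inner ℝ u (z : EuclideanSpace ℝ (Fin n)) * inner ℝ v (z : EuclideanSpace ℝ (Fin n))) ∂μ) :
    Real.exp (∫ z, Real.log (w z) ∂μ) ≤ A.det := by
  have := hμ.isFiniteMeasure
  have hint : ∀ {g : UnitSphere n → ℝ}, Continuous g → Integrable g μ := fun hg =>
    hg.integrable_of_hasCompactSupport (HasCompactSupport.of_compactSpace _)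
  have hlogw : Continuous fun z => Real.log (w z) := hw.log fun z => (hpos z).ne'
  have hsymm : (A : EuclideanSpace ℝ (Fin n) →ₗ[ℝ] EuclideanSpace ℝ (Fin n)).IsSymmetric := by
    intro u v
    change inner ℝ (A u) v = inner ℝ u (A v)
    rw [hA, real_inner_comm, hA]
    simp_rw [mul_comm]
  have hn : Module.finrank ℝ (EuclideanSpace ℝ (Fin n)) = n := finrank_euclideanSpace_fin
  set b := hsymm.eigenvectorBasis hn
  set l := hsymm.eigenvalues hn
  have hl : ∀ i, l i = ∫ z : UnitSphere n, w z *
      (inner ℝ (b i) (z : EuclideanSpace ℝ (Fin n))) ^ 2 ∂μ := fun i => by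
    have h := hA (b i) (b i)
    have h2 := hsymm.apply_eigenvectorBasis hn i
    rw [ContinuousLinearMap.coe_coe] at h2
    rw [h2, inner_smul_left, real_inner_self_eq_norm_sq, b.norm_eq_one] at h
    simpa [← sq] using h
  have hone : ∀ i, ∫ z : UnitSphere n, (inner ℝ (b i) (z : EuclideanSpace ℝ (Fin n))) ^ 2 ∂μ = 1 :=
    fun i => by
    have h := hμ (b i)
    simp_rw [sq_abs] at h
    rw [← h, b.norm_eq_one, one_pow]
  have hlpos : ∀ i, 0 < l i := fun i => by
    rw [hl i]
    refine lt_of_le_of_ne (integral_nonneg fun z => mul_nonneg (hpos z).le (sq_nonneg _))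
      fun h0 => ?_
    have hwb : Continuous fun z : UnitSphere n =>
        w z * (inner ℝ (b i) (z : EuclideanSpace ℝ (Fin n))) ^ 2 := by fun_prop
    have hae := (integral_eq_zero_iff_of_nonneg (fun z => mul_nonneg (hpos z).le (sq_nonneg _))
      (hint hwb)).1 h0.symm
    have h1 : ∫ z : UnitSphere n, (inner ℝ (b i) (z : EuclideanSpace ℝ (Fin n))) ^ 2 ∂μ = 0 := by
      refine integral_eq_zero_of_ae ?_
      filter_upwards [hae] with z hz
      exact (mul_eq_zero.1 hz).resolve_left (hpos z).ne'
    rw [hone i] at h1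
    exact one_ne_zero h1
  have hjensen : ∀ i, ∫ z : UnitSphere n, Real.log (w z) *
      (inner ℝ (b i) (z : EuclideanSpace ℝ (Fin n))) ^ 2 ∂μ ≤ Real.log (l i) := fun i => by
    have h : ∫ z : UnitSphere n, (Real.log (w z) *
        (inner ℝ (b i) (z : EuclideanSpace ℝ (Fin n))) ^ 2) ∂μ ≤
        ∫ z : UnitSphere n, ((Real.log (l i) - 1) *
          (inner ℝ (b i) (z : EuclideanSpace ℝ (Fin n))) ^ 2 +
          (l i)⁻¹ * (w z * (inner ℝ (b i) (z : EuclideanSpace ℝ (Fin n))) ^ 2)) ∂μ := by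
      refine integral_mono (hint (by fun_prop)) (hint (by fun_prop)) fun z => ?_
      -- Jensen through the tangent line of `log` at `l i`.
      have hz := Real.log_le_sub_one_of_pos (div_pos (hpos z) (hlpos i))
      rw [Real.log_div (hpos z).ne' (hlpos i).ne'] at hz
      have hz' : Real.log (w z) ≤ (Real.log (l i) - 1) + (l i)⁻¹ * w z := by
        rw [inv_mul_eq_div]; linarith
      calc _ ≤ _ := mul_le_mul_of_nonneg_right hz' (sq_nonneg _)
        _ = _ := by ring
    rw [integral_add (hint (by fun_prop)) (hint (by fun_prop)), integral_const_mul,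
      integral_const_mul, hone, ← hl, inv_mul_cancel₀ (hlpos i).ne'] at h
    linarith
  have hdet : A.det = ∏ i, l i := by
    have := hsymm.det_eq_prod_eigenvalues hn
    simpa using this
  rw [hdet, ← Real.exp_log (Finset.prod_pos fun i _ => hlpos i),
    Real.log_prod fun i _ => (hlpos i).ne']
  refine Real.exp_le_exp.2 (le_trans (le_of_eq ?_) (Finset.sum_le_sum fun i _ => hjensen i))
  rw [← integral_finsetSum _ fun i _ => hint (by fun_prop)]
  refine integral_congr_ae (Filter.Eventually.of_forall fun z => ?_)
  simp only
  rw [← Finset.mul_sum, b.sum_sq_inner_right, norm_coe_sphere]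
  simp

/-- The map `x ↦ ∫ T(⟨x, z⟩) z dμ(z)`. -/
noncomputable def sphereMap (μ : Measure (UnitSphere n)) (T : ℝ → ℝ) (x : EuclideanSpace ℝ (Fin n)) :
    EuclideanSpace ℝ (Fin n) :=
  ∫ z : UnitSphere n, T (inner ℝ x (z : EuclideanSpace ℝ (Fin n))) •
    (z : EuclideanSpace ℝ (Fin n)) ∂μ

/-- The derivative `∫ T'(⟨x, z⟩) z ⊗ z dμ(z)` of `sphereMap μ T`. -/
noncomputable def sphereMapDeriv (μ : Measure (UnitSphere n)) (T' : ℝ → ℝ)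
    (x : EuclideanSpace ℝ (Fin n)) : EuclideanSpace ℝ (Fin n) →L[ℝ] EuclideanSpace ℝ (Fin n) :=
  ∫ z : UnitSphere n, T' (inner ℝ x (z : EuclideanSpace ℝ (Fin n))) •
    InnerProductSpace.rankOne ℝ (z : EuclideanSpace ℝ (Fin n)) (z : EuclideanSpace ℝ (Fin n)) ∂μ

lemma integrable_of_continuous_sphere [IsFiniteMeasure μ] {F : Type*} [NormedAddCommGroup F]
    {g : UnitSphere n → F} (hg : Continuous g) :
    Integrable g μ :=
  hg.integrable_of_hasCompactSupport (HasCompactSupport.of_compactSpace _)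

lemma continuous_rankOne_self (E : Type*) [NormedAddCommGroup E] [InnerProductSpace ℝ E] :
    Continuous fun z : E => InnerProductSpace.rankOne ℝ z z :=
  (InnerProductSpace.rankOne ℝ (E := E) (F := E)).continuous.clm_apply continuous_id

lemma continuous_rankOne_sphere : Continuous fun z : UnitSphere n =>
    InnerProductSpace.rankOne ℝ (z : EuclideanSpace ℝ (Fin n)) (z : EuclideanSpace ℝ (Fin n)) :=
  (continuous_rankOne_self _).comp continuous_subtype_val

lemma inner_sphereMap [IsFiniteMeasure μ] {T : ℝ → ℝ} (hT : Continuous T)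
    (x v : EuclideanSpace ℝ (Fin n)) :
    inner ℝ v (sphereMap μ T x) = ∫ z : UnitSphere n,
      T (inner ℝ x (z : EuclideanSpace ℝ (Fin n))) * inner ℝ v (z : EuclideanSpace ℝ (Fin n)) ∂μ := by
  rw [sphereMap, ← integral_inner (integrable_of_continuous_sphere (by fun_prop))]
  simp_rw [inner_smul_right]

lemma inner_sphereMapDeriv [IsFiniteMeasure μ] {T' : ℝ → ℝ} (hT : Continuous T')
    (x u v : EuclideanSpace ℝ (Fin n)) :
    inner ℝ (sphereMapDeriv μ T' x u) v = ∫ z : UnitSphere n,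
      T' (inner ℝ x (z : EuclideanSpace ℝ (Fin n))) *
      (inner ℝ u (z : EuclideanSpace ℝ (Fin n)) * inner ℝ v (z : EuclideanSpace ℝ (Fin n))) ∂μ := by
  have hc := continuous_rankOne_sphere (n := n)
  rw [sphereMapDeriv, ContinuousLinearMap.integral_apply
    (integrable_of_continuous_sphere (by fun_prop)), real_inner_comm,
    ← integral_inner (integrable_of_continuous_sphere (by fun_prop))]
  refine integral_congr_ae (Filter.Eventually.of_forall fun z => ?_)
  simp only [smul_apply, InnerProductSpace.rankOne_apply, inner_smul_right]
  rw [real_inner_comm u]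

lemma hasFDerivAt_sphereMap [IsFiniteMeasure μ] {T T' : ℝ → ℝ} (hT : ∀ t, HasDerivAt T (T' t) t)
    (hT' : Continuous T') (x : EuclideanSpace ℝ (Fin n)) :
    HasFDerivAt (sphereMap μ T) (sphereMapDeriv μ T' x) x := by
  have hTc : Continuous T := continuous_iff_continuousAt.2 fun t => (hT t).continuousAt
  have hc := continuous_rankOne_sphere (n := n)
  -- The interval contains `⟨y, z⟩` for every `y` in the unit ball about `x`, so `M` dominates the
  -- derivatives.
  obtain ⟨M, hM⟩ := (isCompact_Icc (a := -(‖x‖ + 1)) (b := ‖x‖ + 1)).exists_bound_of_continuousOn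
    hT'.continuousOn
  refine hasFDerivAt_integral_of_dominated_of_fderiv_le
    (F := fun y (z : UnitSphere n) => T (inner ℝ y (z : EuclideanSpace ℝ (Fin n))) •
      (z : EuclideanSpace ℝ (Fin n)))
    (F' := fun y (z : UnitSphere n) => T' (inner ℝ y (z : EuclideanSpace ℝ (Fin n))) •
      InnerProductSpace.rankOne ℝ (z : EuclideanSpace ℝ (Fin n)) (z : EuclideanSpace ℝ (Fin n)))
    (bound := fun _ => M)
    (Metric.ball_mem_nhds x one_pos)
    (Filter.Eventually.of_forall fun y =>
      (integrable_of_continuous_sphere (by fun_prop)).aestronglyMeasurable)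
    (integrable_of_continuous_sphere (by fun_prop))
    (integrable_of_continuous_sphere (by fun_prop)).aestronglyMeasurable
    (Filter.Eventually.of_forall fun z y hy => ?_) (integrable_const _)
    (Filter.Eventually.of_forall fun z y _ => ?_)
  · rw [norm_smul, InnerProductSpace.norm_rankOne, norm_coe_sphere, mul_one, mul_one]
    refine hM _ (abs_le.1 ((abs_inner_sphere_le y z).trans ?_))
    have : ‖y - x‖ < 1 := by simpa [dist_eq_norm] using hy
    linarith [norm_le_norm_add_norm_sub' y x]
  · have h1 : HasFDerivAt (fun y : EuclideanSpace ℝ (Fin n) =>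
        inner ℝ y (z : EuclideanSpace ℝ (Fin n))) (innerSL ℝ (z : EuclideanSpace ℝ (Fin n))) y := by
      have := (innerSL ℝ (z : EuclideanSpace ℝ (Fin n))).hasFDerivAt (x := y)
      refine this.congr_of_eventuallyEq (Filter.Eventually.of_forall fun y => ?_)
      simp [real_inner_comm]
    have h2 := ((hT _).comp_hasFDerivAt y h1).smul_const (z : EuclideanSpace ℝ (Fin n))
    refine h2.congr_fderiv ?_
    ext1 u
    simp [InnerProductSpace.rankOne_apply, smul_smul]

/-- Pair the difference of the two images with `x - y`: the integrand is nonnegative by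
monotonicity, so if the images agree, `⟨x, z⟩ = ⟨y, z⟩` almost everywhere, and isotropy gives `x =
y`. -/
lemma IsIsotropic.injective_sphereMap (hμ : IsIsotropic μ) {T : ℝ → ℝ} (hT : Continuous T)
    (hmono : StrictMono T) : Function.Injective (sphereMap μ T) := by
  have := hμ.isFiniteMeasure
  intro x y hxy
  have h1 := inner_sphereMap (μ := μ) hT x (x - y)
  have h2 := inner_sphereMap (μ := μ) hT y (x - y)
  have h3 : ∫ z : UnitSphere n, (T (inner ℝ x (z : EuclideanSpace ℝ (Fin n))) -
      T (inner ℝ y (z : EuclideanSpace ℝ (Fin n)))) *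
      (inner ℝ (x - y) (z : EuclideanSpace ℝ (Fin n))) ∂μ = 0 := by
    simp_rw [sub_mul]
    rw [integral_sub (integrable_of_continuous_sphere (by fun_prop))
      (integrable_of_continuous_sphere (by fun_prop)), ← h1, ← h2, hxy, sub_self]
  have key : ∀ a b : ℝ, 0 ≤ (T a - T b) * (a - b) ∧ ((T a - T b) * (a - b) = 0 → a = b) := by
    intro a b
    rcases lt_trichotomy a b with h | rfl | h
    · have := mul_pos_of_neg_of_neg (sub_neg.2 (hmono h)) (sub_neg.2 h)
      exact ⟨this.le, fun h0 => absurd h0 this.ne'⟩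
    · simp
    · have := mul_pos (sub_pos.2 (hmono h)) (sub_pos.2 h)
      exact ⟨this.le, fun h0 => absurd h0 this.ne'⟩
  have hae := (integral_eq_zero_iff_of_nonneg (fun z => by
      simp only [inner_sub_left]; exact (key _ _).1)
    (integrable_of_continuous_sphere (by fun_prop))).1 h3
  have h4 : ‖x - y‖ ^ 2 = 0 := by
    rw [hμ (x - y)]
    refine integral_eq_zero_of_ae ?_
    filter_upwards [hae] with z hz
    simp only [inner_sub_left] at hz ⊢
    rw [(key _ _).2 hz]
    simp
  exact sub_eq_zero.1 (norm_eq_zero.1 (pow_eq_zero_iff two_ne_zero |>.1 h4))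

/-- With `y` the image of `x`, expand `0 ≤ ∫ (T⟨x, z⟩ - ⟨y, z⟩)² dμ`: the cross term is `-2‖y‖²`,
and the last term is `‖y‖²` by isotropy. -/
lemma IsIsotropic.norm_sphereMap_sq_le (hμ : IsIsotropic μ) {T : ℝ → ℝ} (hT : Continuous T)
    (x : EuclideanSpace ℝ (Fin n)) :
    ‖sphereMap μ T x‖ ^ 2 ≤
      ∫ z : UnitSphere n, T (inner ℝ x (z : EuclideanSpace ℝ (Fin n))) ^ 2 ∂μ := by
  have := hμ.isFiniteMeasure
  set y := sphereMap μ T x with hy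
  have h1 := inner_sphereMap (μ := μ) hT x y
  rw [← hy, real_inner_self_eq_norm_sq] at h1
  have h2 := hμ y
  simp_rw [sq_abs] at h2
  have h3 : 0 ≤ ∫ z : UnitSphere n, ((T (inner ℝ x (z : EuclideanSpace ℝ (Fin n))) ^ 2 -
      2 * (T (inner ℝ x (z : EuclideanSpace ℝ (Fin n))) * inner ℝ y (z : EuclideanSpace ℝ (Fin n)))) +
      (inner ℝ y (z : EuclideanSpace ℝ (Fin n))) ^ 2) ∂μ :=
    integral_nonneg fun z => (sq_nonneg (T (inner ℝ x (z : EuclideanSpace ℝ (Fin n))) -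
      inner ℝ y (z : EuclideanSpace ℝ (Fin n)))).trans_eq (by ring)
  rw [integral_add (integrable_of_continuous_sphere (by fun_prop))
    (integrable_of_continuous_sphere (by fun_prop)),
    integral_sub (integrable_of_continuous_sphere (by fun_prop))
    (integrable_of_continuous_sphere (by fun_prop)), integral_const_mul, ← h1, ← h2] at h3
  linarith

/-- The geometric Brascamp-Lieb inequality for an isotropic measure and one function. -/
theorem IsIsotropic.lintegral_exp_integral_log_le (hμ : IsIsotropic μ) {f : ℝ → ℝ}
    (hf : Continuous f) (hfi : Integrable f) (hfpos : ∀ t, 0 < f t) :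
    ∫⁻ x : EuclideanSpace ℝ (Fin n), ENNReal.ofReal (Real.exp
      (∫ z : UnitSphere n, Real.log (f (inner ℝ x (z : EuclideanSpace ℝ (Fin n)))) ∂μ)) ≤
      ENNReal.ofReal ((∫ t, f t) ^ n) := by
  have := hμ.isFiniteMeasure
  obtain ⟨T, T', hT, hT', hpos, hfT⟩ := exists_gaussian_transport hf hfi hfpos
  set c := ∫ t, f t
  have hTc : Continuous T := continuous_iff_continuousAt.2 fun t => (hT t).continuousAt
  have hmono : StrictMono T := strictMono_of_hasDerivAt_pos hT hpos
  have hlogT' : Continuous fun t => Real.log (T' t) := hT'.log fun t => (hpos t).ne'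
  have hc : 0 < c := by
    have h := hfT 0
    have hexp := Real.exp_pos (-Real.pi * T 0 ^ 2)
    have := hfpos 0
    rw [h] at this
    exact pos_of_mul_pos_left (pos_of_mul_pos_left this (hpos 0).le) hexp.le
  have hlog : ∀ t, Real.log (f t) = Real.log c - Real.pi * T t ^ 2 + Real.log (T' t) := fun t => by
    rw [hfT t, Real.log_mul (by positivity) (hpos t).ne', Real.log_mul hc.ne' (Real.exp_ne_zero _),
      Real.log_exp]
    ring
  have hbound : ∀ x : EuclideanSpace ℝ (Fin n), ENNReal.ofReal (Real.exp
      (∫ z : UnitSphere n, Real.log (f (inner ℝ x (z : EuclideanSpace ℝ (Fin n)))) ∂μ)) ≤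
      ENNReal.ofReal (c ^ n) * (ENNReal.ofReal |(sphereMapDeriv μ T' x).det| *
        ENNReal.ofReal (Real.exp (-Real.pi * ‖sphereMap μ T x‖ ^ 2))) := fun x => by
    rw [← ENNReal.ofReal_mul (abs_nonneg _), ← ENNReal.ofReal_mul (by positivity)]
    refine ENNReal.ofReal_le_ofReal ?_
    have hdet := hμ.exp_integral_log_le_det (A := sphereMapDeriv μ T' x)
      (w := fun z => T' (inner ℝ x (z : EuclideanSpace ℝ (Fin n)))) (by fun_prop)
      (fun z => hpos _) (inner_sphereMapDeriv hT' x)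
    have hlogc : Continuous fun z : UnitSphere n =>
        Real.log (T' (inner ℝ x (z : EuclideanSpace ℝ (Fin n)))) := hlogT'.comp (by fun_prop)
    simp_rw [hlog]
    rw [integral_add (integrable_of_continuous_sphere (by fun_prop))
      (integrable_of_continuous_sphere hlogc),
      integral_sub (integrable_const _) (integrable_of_continuous_sphere (by fun_prop)),
      integral_const_mul, integral_const, hμ.measureReal_univ, smul_eq_mul, Real.exp_add,
      sub_eq_add_neg, Real.exp_add, Real.exp_nat_mul, Real.exp_log hc, mul_assoc]
    have h1 := hμ.norm_sphereMap_sq_le hTc x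
    have h2 : Real.exp (-(Real.pi * ∫ z : UnitSphere n,
        T (inner ℝ x (z : EuclideanSpace ℝ (Fin n))) ^ 2 ∂μ)) ≤
        Real.exp (-Real.pi * ‖sphereMap μ T x‖ ^ 2) := by
      rw [neg_mul]
      gcongr
    rw [mul_comm |(sphereMapDeriv μ T' x).det|]
    gcongr
    exact hdet.trans (le_abs_self _)
  have hgauss : ∫⁻ y : EuclideanSpace ℝ (Fin n),
      ENNReal.ofReal (Real.exp (-Real.pi * ‖y‖ ^ 2)) = 1 := by
    have h := GaussianFourier.integral_rexp_neg_mul_sq_norm (V := EuclideanSpace ℝ (Fin n))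
      Real.pi_pos
    rw [div_self Real.pi_ne_zero, Real.one_rpow] at h
    rw [← ofReal_integral_eq_lintegral_ofReal (Integrable.of_integral_ne_zero (by rw [h]; simp))
      (Filter.Eventually.of_forall fun y => (Real.exp_pos _).le), h, ENNReal.ofReal_one]
  calc _ ≤ ∫⁻ x : EuclideanSpace ℝ (Fin n), ENNReal.ofReal (c ^ n) *
        (ENNReal.ofReal |(sphereMapDeriv μ T' x).det| *
          ENNReal.ofReal (Real.exp (-Real.pi * ‖sphereMap μ T x‖ ^ 2))) := lintegral_mono hbound
    _ = ENNReal.ofReal (c ^ n) * ∫⁻ x : EuclideanSpace ℝ (Fin n),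
        (ENNReal.ofReal |(sphereMapDeriv μ T' x).det| *
          ENNReal.ofReal (Real.exp (-Real.pi * ‖sphereMap μ T x‖ ^ 2))) :=
        lintegral_const_mul' _ _ ENNReal.ofReal_ne_top
    _ ≤ ENNReal.ofReal (c ^ n) * 1 := by
        gcongr
        -- Injectivity is enough: the Gaussian integral over the image is at most the full one,
        -- which is 1.
        have h := lintegral_image_eq_lintegral_abs_det_fderiv_mul volume MeasurableSet.univ
          (fun x _ => (hasFDerivAt_sphereMap (μ := μ) hT hT' x).hasFDerivWithinAt)
          (hμ.injective_sphereMap hTc hmono).injOn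
          (fun y => ENNReal.ofReal (Real.exp (-Real.pi * ‖y‖ ^ 2)))
        rw [Measure.restrict_univ] at h
        rw [← h, ← hgauss]
        exact setLIntegral_le_lintegral _ _
    _ = _ := mul_one _

lemma integral_exp_neg_abs_rpow {p : ℝ} (hp : 0 < p) :
    ∫ t : ℝ, Real.exp (-|t| ^ p) = 2 * Real.Gamma (1 / p + 1) := by
  rw [integral_comp_abs (f := fun t => Real.exp (-t ^ p)), integral_exp_neg_rpow hp]

lemma IsIsotropic.integral_exp_neg_bodyNorm_le (hμ : IsIsotropic μ) {p : ℝ} (hp : 1 ≤ p) :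
    ∫ x, Real.exp (-bodyNorm μ p x ^ p) ≤ (2 * Real.Gamma (1 / p + 1)) ^ n := by
  have := hμ.isFiniteMeasure
  have hp0 : 0 < p := by linarith
  have hG : 0 < Real.Gamma (1 / p + 1) := Real.Gamma_pos_of_pos (by positivity)
  have hcont : Continuous fun t : ℝ => Real.exp (-|t| ^ p) := (continuous_abs_rpow hp0.le).neg.rexp
  have h := hμ.lintegral_exp_integral_log_le hcont
    (Integrable.of_integral_ne_zero (by rw [integral_exp_neg_abs_rpow hp0]; positivity))
    fun t => Real.exp_pos _
  simp_rw [Real.log_exp, integral_neg, ← bodyNorm_rpow hp0.ne', integral_exp_neg_abs_rpow hp0] at h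
  have hcont' : Continuous fun x => Real.exp (-bodyNorm μ p x ^ p) :=
    ((continuous_bodyNorm hp).rpow_const fun _ => Or.inr hp0.le).neg.rexp
  rw [integral_eq_lintegral_of_nonneg_ae (Filter.Eventually.of_forall fun x => (Real.exp_pos _).le)
    hcont'.aestronglyMeasurable]
  exact ENNReal.toReal_le_of_le_ofReal (by positivity) h

/-- Both volumes are an integral of `exp (-N^p)` over `Γ(n/p + 1)`; for `ℓ_p^n` the integral
factorises and equals the Brascamp-Lieb bound. -/
theorem IsIsotropic.volume_body_le (hμ : IsIsotropic μ) (hn : 1 ≤ n) {p : ℝ} (hp : 1 ≤ p) :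
    volume (body μ p) ≤ volume (lpBall n p) := by
  have := hμ.isFiniteMeasure
  have hp0 : 0 < p := by linarith
  have : Nonempty (Fin n) := ⟨⟨0, hn⟩⟩
  have h0 : bodyNorm μ p 0 = 0 := bodyNorm_zero hp0
  have hdef : ∀ {x}, bodyNorm μ p x = 0 → x = 0 := fun {x} hx => by
    by_contra hne
    exact (hμ.bodyNorm_pos hn hp hne).ne' hx
  have hsmul : ∀ (r : ℝ) x, bodyNorm μ p (r • x) ≤ |r| * bodyNorm μ p x := fun r x =>
    (bodyNorm_smul hp0 r x).le
  have hball : volume (lpBall n p) = ENNReal.ofReal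
      ((2 * Real.Gamma (1 / p + 1)) ^ n / Real.Gamma (n / p + 1)) := by
    have h := volume_sum_rpow_le (Fin n) hp 1
    rw [← (EuclideanSpace.volume_preserving_symm_measurableEquiv_toLp (Fin n)).measure_preimage_equiv] at h
    simpa [lpBall] using h
  rw [hball, body, measure_le_eq_lt volume h0 (bodyNorm_neg p) (bodyNorm_add_le hp) hdef hsmul 1,
    measure_lt_one_eq_integral_div_gamma volume h0 (bodyNorm_neg p) (bodyNorm_add_le hp) hdef hsmul
      hp0, finrank_euclideanSpace_fin]
  have hG : 0 < Real.Gamma (n / p + 1) := Real.Gamma_pos_of_pos (by positivity)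
  exact ENNReal.ofReal_le_ofReal (by gcongr; exact hμ.integral_exp_neg_bodyNorm_le hp)

end BrascampLieb

end IsotropicSphere

open IsotropicSphere in
theorem mainTheorem8 :
    (∀ (n : ℕ), 1 ≤ n → ∀ μ : Measure (UnitSphere n), IsIsotropic μ →
      -- (i)
      (∀ q : ℝ, 1 ≤ q →
        Integrable (fun x => bodyNorm μ q x ^ q) (gaussian n) ∧
        ∫ x, bodyNorm μ q x ^ q ∂(gaussian n) = gaussianMoment q ^ q * μ.real Set.univ) ∧
      -- (ii)
      μ Set.univ = (n : ENNReal) ∧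
      -- (iii)
      (∀ p : ℝ, 2 ≤ p → ∀ x : EuclideanSpace ℝ (Fin n), bodyNorm μ p x ≤ ‖x‖) ∧
      (∀ p q : ℝ, 1 ≤ p → p < q → ∀ x : EuclideanSpace ℝ (Fin n),
        bodyNorm μ p x ≤ (n : ℝ) ^ (1 / p - 1 / q) * bodyNorm μ q x) ∧
      -- (iv)
      (∀ p : ℝ, 1 ≤ p → volume (body μ p) ≤ volume (lpBall n p))) ∧
    -- (v)
    (∃ c : ℝ, 0 < c ∧
      ∀ (n : ℕ), 1 ≤ n → ∀ μ : Measure (UnitSphere n), IsIsotropic μ →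
        ∀ q : ℝ, 1 ≤ q → c * (n : ℝ) ^ (min 1 (2 / q)) ≤ criticalDim (bodyNorm μ q)) ∧
    -- (vi)
    (∃ c c₁ c₂ c₃ : ℝ, 0 < c ∧ 0 < c₁ ∧ 0 < c₂ ∧ 0 < c₃ ∧
      ∀ (n : ℕ), 1 ≤ n → ∀ μ : Measure (UnitSphere n), IsIsotropic μ →
        ∀ q : ℝ, 2 ≤ q → q ≤ c * Real.log n →
          c₁ * (q ^ (1 / 2 : ℝ) * (n : ℝ) ^ (1 / q)) ≤
              (∫ x, bodyNorm μ q x ^ 2 ∂(gaussian n)) ^ (1 / 2 : ℝ) ∧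
          (∫ x, bodyNorm μ q x ^ 2 ∂(gaussian n)) ^ (1 / 2 : ℝ) ≤
              c₂ * (q ^ (1 / 2 : ℝ) * (n : ℝ) ^ (1 / q)) ∧
          c₃ * q * (n : ℝ) ^ (2 / q) ≤ criticalDim (bodyNorm μ q)) := by
  refine ⟨fun n hn μ hμ => ⟨fun q hq => ?_, hμ.measure_univ, fun p hp x => hμ.bodyNorm_le_norm hp x,
    fun p q hp hpq x => hμ.bodyNorm_le hp hpq.le x, fun p hp => hμ.volume_body_le hn hp⟩,
    ⟨min 1 ((∫ t : ℝ, |t| ∂(gaussianReal 0 1)) ^ 2),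
      lt_min one_pos (pow_pos integral_abs_gaussianReal_pos 2),
      fun n hn μ hμ q hq => hμ.rpow_le_criticalDim hn hq⟩,
    ⟨1 / 2, (1 / 24) ^ (1 / 2 : ℝ), 4 ^ (1 / 2 : ℝ), 1 / 24, by norm_num, by positivity,
      by positivity, by norm_num,
      fun n hn μ hμ q hq hqn => hμ.integral_bodyNorm_sq_rpow_bounds hn hq hqn⟩⟩
  have := hμ.isFiniteMeasure
  have hq0 : 0 < q := by linarith
  exact ⟨integrable_bodyNorm_rpow hq0, by
    rw [gaussianMoment_rpow hq0.ne', integral_bodyNorm_rpow hq0]⟩
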